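/- Let $N\ge 1$ be an integer and let $b,\sigma,p$ be real numbers with $0<b<\min\{N,4\}$, $0<\sigma<4^*$ and $1<p<\frac{(2\sigma+2)N}{N-b}$, where $4^*=\frac{4-b}{N-4}$ if $N\ge 5$ and $4^*=\infty$ if $1\le N\le 4$. Let $\dot{\mathcal S}(\mathbb R^N)$ be the space of complex-valued Schwartz functions $\varphi$ with $(D^\alpha\widehat\varphi)(0)=0$ for all multi-indices $\alpha$. Let $\dot H^2\cap L^p$ be the space of all $u\in L^p(\mathbb R^N;\mathbb C)$ for which there is a (necessarily unique) $g\in L^2(\mathbb R^N;\mathbb C)$, denoted $D^2u$, with $D^2u=-\Delta u$ as functionals on $\dot{\mathcal S}(\mathbb R^N)$, that is, $\int u\,(-\Delta\varphi)\,dx=\int g\,\varphi\,dx$ for all $\varphi\in\dot{\mathcal S}(\mathbb R^N)$. Equip it with the norm $\max\{\|u\|_{L^p},\|D^2u\|_{L^2}\}$ (equivalent to $\|u\|_{L^p}+\|D^2u\|_{L^2}$). Let $L^{2\sigma+2}_b=L^{2\sigma+2}(|x|^{-b}dx)$ be the space of measurable $u:\mathbb R^N\to\mathbb C$ (modulo equality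 almost everywhere) with $\|u\|_{L^{2\sigma+2}_b}=\left(\int_{\mathbb R^N}|x|^{-b}|u|^{2\sigma+2}\,dx\right)^{1/(2\sigma+2)}<\infty$. Then every $u\in\dot H^2\cap L^p$ belongs to $L^{2\sigma+2}_b$, and the embedding $$\dot H^2\cap L^p\hookrightarrow L^{2\sigma+2}_b,\qquad u\mapsto u,$$ is a continuous and compact linear map. -/

import Mathlib

open MeasureTheory SchwartzMap TemperedDistribution Laplacian FourierTransform
open scoped ENNReal

noncomputable section

/-- The space `ℝ^N` with its Euclidean norm. -/
abbrev RN (N : ℕ) : Type := EuclideanSpace ℝ (Fin N)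

/-- The Schwartz functions on `ℝ^N` all of whose Fourier-side derivatives vanish at the origin. The
topological dual of this space is the space of tempered distributions modulo polynomials. -/
def dotSchwartz (N : ℕ) : Submodule ℂ 𝓢(RN N, ℂ) where
  carrier := {φ | ∀ n : ℕ, iteratedFDeriv ℝ n (𝓕 φ : 𝓢(RN N, ℂ)) 0 = 0}
  zero_mem' n := by
    have h : ((𝓕 (0 : 𝓢(RN N, ℂ)) : 𝓢(RN N, ℂ)) : RN N → ℂ) = 0 := by
      rw [FourierTransform.fourier_zero]; rfl
    rw [h]; simp
  add_mem' {φ ψ} hφ hψ n := by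
    have h : ((𝓕 (φ + ψ) : 𝓢(RN N, ℂ)) : RN N → ℂ)
        = (𝓕 φ : 𝓢(RN N, ℂ)) + (𝓕 ψ : 𝓢(RN N, ℂ)) := by
      rw [FourierTransform.fourier_add]; rfl
    rw [h, iteratedFDeriv_add_apply ((𝓕 φ : 𝓢(RN N, ℂ)).smooth n).contDiffAt
      ((𝓕 ψ : 𝓢(RN N, ℂ)).smooth n).contDiffAt, hφ n, hψ n, add_zero]
  smul_mem' c φ hφ n := by
    have h : ((𝓕 (c • φ) : 𝓢(RN N, ℂ)) : RN N → ℂ) = c • (𝓕 φ : 𝓢(RN N, ℂ)) := by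
      rw [FourierTransform.fourier_smul]; rfl
    rw [h, iteratedFDeriv_const_smul_apply ((𝓕 φ : 𝓢(RN N, ℂ)).smooth n).contDiffAt, hφ n,
      smul_zero]

/-- The intersection of the homogeneous Sobolev space of order two with `L^p`, for complex-valued
functions on `ℝ^N`. A function `u ∈ L^p` lies in the homogeneous Sobolev space iff, as a functional
on `dotSchwartz N`, its image under `D² = -Δ` (the Fourier multiplier `|ξ|²`) is given by a function
`g ∈ L²`. Such a `g` is unique, because `dotSchwartz N` is dense in `L²`, so the intersection is
represented by the pairs `(u, D² u)`. The norm is `max ‖u‖_{L^p} ‖D² u‖_{L²}`, which is equivalent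
to the sum of the two norms. -/
def HdotTwoInterLp (N : ℕ) (p : ℝ≥0∞) [Fact (1 ≤ p)] :
    Submodule ℂ (Lp ℂ p (volume : Measure (RN N)) × Lp ℂ 2 (volume : Measure (RN N))) where
  carrier := {w | ∀ φ ∈ dotSchwartz N,
    (w.1 : 𝓢'(RN N, ℂ)) (-(Δ φ)) = (w.2 : 𝓢'(RN N, ℂ)) φ}
  zero_mem' φ _ := by
    simp only [← Lp.toTemperedDistributionCLM_apply, Prod.fst_zero, Prod.snd_zero, map_zero]
    rfl
  add_mem' {v w} hv hw φ hφ := by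
    have h1 := hv φ hφ
    have h2 := hw φ hφ
    simp only [← Lp.toTemperedDistributionCLM_apply, Prod.fst_add, Prod.snd_add, map_add] at *
    exact congrArg₂ (· + ·) h1 h2
  smul_mem' c w hw φ hφ := by
    have h1 := hw φ hφ
    simp only [← Lp.toTemperedDistributionCLM_apply, Prod.smul_fst, Prod.smul_snd,
      map_smul] at *
    exact congrArg (c • ·) h1

/-- The measure `|x|^{-b} dx` on `ℝ^N`; `Lp ℂ q (weightedVolume N b)` is the weighted Lebesgue space
`L^q(|x|^{-b} dx)`. -/
def weightedVolume (N : ℕ) (b : ℝ) : Measure (RN N) :=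
  volume.withDensity fun x => ENNReal.ofReal (‖x‖ ^ (-b))

/-- The exponent `4^*`, equal to `(4 - b) / (N - 4)` if `N ≥ 5` and to `∞` if `N ≤ 4`. -/
def fourStar (N : ℕ) (b : ℝ) : EReal :=
  if 5 ≤ N then (((4 - b) / ((N : ℝ) - 4) : ℝ) : EReal) else ⊤

end

open scoped RealInnerProductSpace
open Filter Topology

/-! Write q = 2σ+2 and Q = qN/(N-b), so that q/Q = 1 - b/N. The weight |x|^{-b} lies in L^s of the
unit ball when bs < N and in L^s of its complement when bs > N. Hölder's inequality on the two
pieces therefore bounds the weighted L^q norm by an L^{r₁} and an L^{r₂} norm with q < r₂ < Q < r₁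
(`exists_eLpNorm_weightedVolume_le`). The conditions σ < 4^* and p < Q say that Q lies strictly
below the Sobolev exponent of Ḣ² and strictly above p; hence r₁, r₂ can be chosen subcritical and at
least p (`exists_exponents`).

For such r, let P_k u be the average of u against the kernel κ of mass one dilated to scale 2^{-k}.
The increment P_{k+1}u - P_k u equals 4^{-k} times an average of D²u against a second kernel E,
obtained from κ by dividing by the symbol of -Δ on an annulus of frequencies. The dilations of E are
admissible test functions, so this is just the definition of D²u (`smoothing_sub_smoothing`).
Bernstein's inequality from L² to L^r bounds the increment by a multiple of
2^{k(N(1/2-1/r)-2)}‖D²u‖₂, a geometric sequence of ratio less than one. Hence u - P_k u tends to 0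
in L^r, and so in the weighted space, uniformly on bounded sets. Together with Bernstein from L^p to
L^{r₁} and L^{r₂} for P_0 this gives continuity.

For compactness, fix k. The part of P_k u outside a large ball is small because the tail of the
weight is. On the ball, P_k u is Lipschitz uniformly for bounded u, so it may be replaced by its
values at finitely many points, which are continuous functionals of u. The embedding is thus an
operator-norm limit of finite-rank maps (`isCompactOperator_of_forall_exists_simpleFunc`). -/

/-! ### Dilated kernels and their Fourier transforms. -/

/-- The `L¹`-normalised dilation `y ↦ |l|^N κ(l(y - x))` of a Schwartz function, centred at `x`. -/
noncomputable def dilate {N : ℕ} (l : ℝˣ) (x : RN N) (κ : 𝓢(RN N, ℂ)) : 𝓢(RN N, ℂ) :=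
  (|(l : ℝ)| ^ N) • compSubConstCLM ℂ x
    (compCLMOfContinuousLinearEquiv ℂ (ContinuousLinearEquiv.smulLeft (R₁ := ℝ) l) κ)

theorem dilate_apply {N : ℕ} (l : ℝˣ) (x : RN N) (κ : 𝓢(RN N, ℂ)) (y : RN N) :
    dilate l x κ y = (|(l : ℝ)| ^ N) • κ ((l : ℝ) • (y - x)) := rfl

/-- Translation becomes a phase; the `L¹` normalisation cancels the Jacobian, so dilation only
rescales the frequency. -/
theorem fourier_dilate {N : ℕ} (l : ℝˣ) (x : RN N) (κ : 𝓢(RN N, ℂ)) (ξ : RN N) :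
    (𝓕 (dilate l x κ)) ξ = Real.fourierChar (-⟪x, ξ⟫) • (𝓕 κ) ((l : ℝ)⁻¹ • ξ) := by
  have hl : (l : ℝ) ≠ 0 := l.ne_zero
  rw [fourier_coe, fourier_coe, Real.fourier_eq, Real.fourier_eq]
  calc ∫ v, Real.fourierChar (-⟪v, ξ⟫) • dilate l x κ v
      = ∫ v, Real.fourierChar (-⟪x, ξ⟫) • (|(l : ℝ)| ^ N) •
          (Real.fourierChar (-⟪(l : ℝ) • (v - x), (l : ℝ)⁻¹ • ξ⟫) • κ ((l : ℝ) • (v - x))) := by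
        congr 1 with v
        rw [dilate_apply, smul_comm (|(l : ℝ)| ^ N) (Real.fourierChar _), smul_smul,
          ← AddChar.map_add_eq_mul, real_inner_smul_left, real_inner_smul_right, inner_sub_left,
          mul_inv_cancel_left₀ hl]
        ring_nf
    _ = Real.fourierChar (-⟪x, ξ⟫) • (|(l : ℝ)| ^ N) • ∫ v,
          (Real.fourierChar (-⟪(l : ℝ) • (v - x), (l : ℝ)⁻¹ • ξ⟫) • κ ((l : ℝ) • (v - x))) := by
        simp_rw [Circle.smul_def]
        rw [integral_smul, integral_smul]
    _ = _ := by
        rw [integral_sub_right_eq_self (μ := volume) (fun v : RN N =>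
          (Real.fourierChar (-⟪(l : ℝ) • v, (l : ℝ)⁻¹ • ξ⟫) • κ ((l : ℝ) • v))) x,
          Measure.integral_comp_smul volume (fun v : RN N =>
          (Real.fourierChar (-⟪v, (l : ℝ)⁻¹ • ξ⟫) • κ v)) (l : ℝ), smul_smul (|(l : ℝ)| ^ N)]
        simp [abs_inv, hl]

theorem lintegral_comp_smul_eq {N : ℕ} (f : RN N → ℝ≥0∞) {l : ℝ} (hl : l ≠ 0) :
    ∫⁻ x, f (l • x) = ENNReal.ofReal ((|l| ^ N)⁻¹) * ∫⁻ x, f x := by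
  have h := Measure.map_addHaar_smul (volume : Measure (RN N)) hl
  have h2 : ∫⁻ x, f (l • x) = ∫⁻ x, f x ∂(Measure.map (fun x => l • x) volume) :=
    ((Homeomorph.smulOfNeZero l hl).measurableEmbedding.lintegral_map f).symm
  rw [h2, h, lintegral_smul_measure]
  simp [abs_inv]

theorem lintegral_dilate_rpow {N : ℕ} (l : ℝˣ) (x : RN N) (κ : 𝓢(RN N, ℂ)) {s : ℝ} (hs : 0 ≤ s) :
    ∫⁻ y, ‖dilate l x κ y‖ₑ ^ s =
      ENNReal.ofReal ((|(l : ℝ)| ^ N) ^ (s - 1)) * ∫⁻ y, ‖κ y‖ₑ ^ s := by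
  have hl : 0 < |(l : ℝ)| ^ N := pow_pos (abs_pos.2 l.ne_zero) _
  have h1 : ∀ y, ‖dilate l x κ y‖ₑ ^ s = ENNReal.ofReal ((|(l : ℝ)| ^ N) ^ s) *
      (fun z => ‖κ ((l : ℝ) • z)‖ₑ ^ s) (y - x) := by
    intro y
    rw [dilate_apply, enorm_smul, ENNReal.mul_rpow_of_nonneg _ _ hs, Real.enorm_of_nonneg hl.le,
      ENNReal.ofReal_rpow_of_pos hl]
  simp_rw [h1]
  rw [lintegral_const_mul' _ _ ENNReal.ofReal_ne_top,
    lintegral_sub_right_eq_self (fun z => ‖κ ((l : ℝ) • z)‖ₑ ^ s) x,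
    lintegral_comp_smul_eq (fun z => ‖κ z‖ₑ ^ s) l.ne_zero, ← mul_assoc,
    ← ENNReal.ofReal_mul (by positivity), Real.rpow_sub_one hl.ne']
  rfl

/-! ### Littlewood–Paley kernels. -/

/-- `-Δ` is the Fourier multiplier `4π²|ξ|²`. -/
theorem fourier_neg_laplacian {N : ℕ} (f : 𝓢(RN N, ℂ)) (ξ : RN N) :
    (𝓕 (-(Δ f))) ξ = ((2 * Real.pi) ^ 2 * ‖ξ‖ ^ 2) • (𝓕 f) ξ := by
  rw [SchwartzMap.laplacian_eq_fourierMultiplierCLM, SchwartzMap.fourierMultiplierCLM_apply,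
    neg_smul, neg_neg,
    FourierTransform.fourier_smul, fourier_fourierInv_eq, smul_apply,
    SchwartzMap.smulLeftCLM_apply_apply (by fun_prop), smul_smul]

theorem schwartz_ext_fourier {N : ℕ} {f g : 𝓢(RN N, ℂ)} (h : ∀ ξ, (𝓕 f) ξ = (𝓕 g) ξ) : f = g := by
  have : (𝓕 f : 𝓢(RN N, ℂ)) = 𝓕 g := SchwartzMap.ext h
  rw [← fourierInv_fourier_eq (F := 𝓢(RN N, ℂ)) f, this, fourierInv_fourier_eq]

/-- Derivatives at the origin depend only on the germ there, so a frequency support away from 0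
suffices. -/
theorem mem_dotSchwartz_of_eventuallyEq {N : ℕ} {φ : 𝓢(RN N, ℂ)}
    (h : ((𝓕 φ : 𝓢(RN N, ℂ)) : RN N → ℂ) =ᶠ[𝓝 0] 0) : φ ∈ dotSchwartz N := by
  intro n
  rw [(h.iteratedFDeriv ℝ n).eq_of_nhds]
  simp

open scoped ContDiff in
/-- A low-frequency cut-off kernel `κ` of total mass one, together with a kernel `E` whose
dilations lie in `dotSchwartz` and satisfy `-Δ E_l = l² (κ_{2l} - κ_l)`. -/
theorem exists_littlewoodPaley_kernels (N : ℕ) : ∃ κ E : 𝓢(RN N, ℂ), ∫ y, κ y = 1 ∧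
    ∀ (l m : ℝˣ) (x : RN N), (m : ℝ) = 2 * l → dilate l x E ∈ dotSchwartz N ∧
      -(Δ (dilate l x E)) = ((l : ℝ) ^ 2) • (dilate m x κ - dilate l x κ) := by
  let η : ContDiffBump (0 : RN N) := ⟨1, 2, by norm_num, by norm_num⟩
  have hη1 : ∀ ξ : RN N, ‖ξ‖ ≤ 1 → η ξ = 1 := fun ξ h =>
    η.one_of_mem_closedBall (by simpa using h)
  have hη0 : ∀ ξ : RN N, 2 ≤ ‖ξ‖ → η ξ = 0 := fun ξ h => η.zero_of_le_dist (by simpa using h)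
  have hηs : ContDiff ℝ ∞ η := η.contDiff
  let m0 : RN N → ℂ := fun ξ => (η ξ : ℂ)
  -- The difference of the kernels at scales 2l and l has symbol η(ξ/2l) - η(ξ/l), up to a phase.
  -- Dividing by 4π²|ξ|² gives l⁻² w(ξ/l). Both cut-offs equal 1 near the origin, so the singularity
  -- of the quotient is never met.
  let w : RN N → ℝ := fun ξ => (η ((2 : ℝ)⁻¹ • ξ) - η ξ) * ((2 * Real.pi) ^ 2 * ‖ξ‖ ^ 2)⁻¹
  let m1 : RN N → ℂ := fun ξ => (w ξ : ℂ)
  have hw0 : ∀ ξ : RN N, ‖ξ‖ < 1 → w ξ = 0 := by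
    intro ξ h
    have h2 : ‖(2 : ℝ)⁻¹ • ξ‖ ≤ 1 := by rw [norm_smul]; norm_num; linarith
    simp [w, hη1 ξ h.le, hη1 _ h2]
  have hwc : ∀ ξ : RN N, 4 < ‖ξ‖ → w ξ = 0 := by
    intro ξ h
    have h2 : 2 ≤ ‖(2 : ℝ)⁻¹ • ξ‖ := by rw [norm_smul]; norm_num; linarith
    simp [w, hη0 ξ (by linarith), hη0 _ h2]
  have hm0c : HasCompactSupport m0 := η.hasCompactSupport.comp_left (g := fun t : ℝ => (t : ℂ)) rfl
  have hm0s : ContDiff ℝ ∞ m0 := Complex.ofRealCLM.contDiff.comp hηs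
  have hwcs : HasCompactSupport w := by
    refine HasCompactSupport.intro (isCompact_closedBall (0 : RN N) 4) fun ξ hξ => hwc ξ ?_
    simpa using hξ
  have hws : ContDiff ℝ ∞ w := by
    rw [contDiff_iff_contDiffAt]
    intro ξ
    by_cases hξ : ξ = 0
    · have : w =ᶠ[𝓝 ξ] fun _ => 0 := by
        rw [hξ]
        filter_upwards [Metric.ball_mem_nhds (0 : RN N) one_pos] with z hz
        exact hw0 z (by simpa using hz)
      exact contDiffAt_const.congr_of_eventuallyEq this
    · refine ContDiffAt.mul ?_ (ContDiffAt.inv ?_ ?_)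
      · exact ((hηs.comp (contDiff_const_smul _)).sub hηs).contDiffAt
      · exact (contDiff_const.mul (contDiff_norm_sq ℝ)).contDiffAt
      · have := norm_pos_iff.2 hξ
        positivity
  have hm1c : HasCompactSupport m1 := hwcs.comp_left (g := fun t : ℝ => (t : ℂ)) rfl
  have hm1s : ContDiff ℝ ∞ m1 := Complex.ofRealCLM.contDiff.comp hws
  let κ : 𝓢(RN N, ℂ) := 𝓕⁻ (hm0c.toSchwartzMap hm0s)
  let E : 𝓢(RN N, ℂ) := 𝓕⁻ (hm1c.toSchwartzMap hm1s)
  have hκ : ∀ ξ, (𝓕 κ : 𝓢(RN N, ℂ)) ξ = η ξ := fun ξ => by simp only [κ, fourier_fourierInv_eq]; rfl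
  have hE : ∀ ξ, (𝓕 E : 𝓢(RN N, ℂ)) ξ = w ξ := fun ξ => by simp only [E, fourier_fourierInv_eq]; rfl
  refine ⟨κ, E, ?_, fun l m x hm => ⟨?_, ?_⟩⟩
  · have := hκ 0
    rw [fourier_coe, Real.fourier_eq, hη1 0 (by simp)] at this
    simpa using this
  · have hl := abs_pos.2 l.ne_zero
    refine mem_dotSchwartz_of_eventuallyEq ?_
    filter_upwards [Metric.ball_mem_nhds (0 : RN N) hl] with ξ hξ
    rw [fourier_dilate, hE, hw0]
    · simp
    · rw [norm_smul, norm_inv, Real.norm_eq_abs]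
      rw [mem_ball_zero_iff] at hξ
      rwa [inv_mul_lt_iff₀ hl, mul_one]
  · refine schwartz_ext_fourier fun ξ => ?_
    rw [fourier_neg_laplacian, FourierTransform.fourier_smul, sub_eq_add_neg,
      FourierTransform.fourier_add, FourierTransform.fourier_neg, fourier_dilate]
    simp only [smul_apply, add_apply, neg_apply, fourier_dilate,
      hκ, hE]
    rw [← smul_neg, ← smul_add, smul_comm (_ : ℝ) (Real.fourierChar _),
      smul_comm (_ : ℝ) (Real.fourierChar _)]
    congr 1
    have hl := l.ne_zero
    have h2 : (m : ℝ)⁻¹ • ξ = (2 : ℝ)⁻¹ • (l : ℝ)⁻¹ • ξ := by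
      rw [hm, smul_smul, mul_inv]
    rw [h2, ← sub_eq_add_neg, ← Complex.ofReal_sub, ← Complex.coe_smul, ← Complex.coe_smul]
    simp only [smul_eq_mul, ← Complex.ofReal_mul]
    congr 1
    simp only [w]
    have h3 : ‖(l : ℝ)⁻¹ • ξ‖ ^ 2 = ((l : ℝ) ^ 2)⁻¹ * ‖ξ‖ ^ 2 := by
      rw [norm_smul, mul_pow, norm_inv, inv_pow, Real.norm_eq_abs, sq_abs]
    rw [h3]
    by_cases hξ : ξ = 0
    · simp [hξ]
    · have := norm_pos_iff.2 hξ
      field_simp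

/-! ### Young's inequality and interpolation. -/

/-- Young's inequality `L¹ * L^a → L^a` for nonnegative functions. -/
theorem lintegral_rpow_convolution_le {N : ℕ} {a a' : ℝ} (h : a.HolderConjugate a')
    {k f : RN N → ℝ≥0∞} (hk : Measurable k) (hf : AEMeasurable f) :
    ∫⁻ x, (∫⁻ y, k (y - x) * f y) ^ a ≤ (∫⁻ y, k y) ^ a * ∫⁻ y, f y ^ a := by
  have ha := h.pos
  have ha' := h.symm.pos
  have hkx : ∀ x, Measurable fun y => k (y - x) := fun x => hk.comp (measurable_id.sub_const x)
  have hx : ∀ x, (∫⁻ y, k (y - x) * f y) ^ a ≤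
      (∫⁻ y, k y) ^ (a / a') * ∫⁻ y, k (y - x) * f y ^ a := by
    intro x
    -- Splitting k = k^{1/a} k^{1/a'} lets Hölder act against the measure k(y - x) dy.
    have h1 : ∀ y, k (y - x) * f y =
        ((fun y => k (y - x) ^ (1 / a) * f y) * fun y => k (y - x) ^ (1 / a')) y := by
      intro y
      have : k (y - x) ^ (1 / a) * k (y - x) ^ (1 / a') = k (y - x) := by
        rw [← ENNReal.rpow_add_of_nonneg _ _ (by positivity) (by positivity), one_div, one_div,
          h.inv_add_inv_eq_one, ENNReal.rpow_one]
      simp only [Pi.mul_apply]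
      rw [mul_right_comm, this]
    have h2 := ENNReal.lintegral_mul_le_Lp_mul_Lq volume h
      (f := fun y => k (y - x) ^ (1 / a) * f y) (g := fun y => k (y - x) ^ (1 / a'))
      (((hkx x).pow_const _).aemeasurable.mul hf) ((hkx x).pow_const _).aemeasurable
    simp_rw [h1]
    refine (ENNReal.rpow_le_rpow h2 ha.le).trans (le_of_eq ?_)
    rw [ENNReal.mul_rpow_of_nonneg _ _ ha.le, ← ENNReal.rpow_mul, ← ENNReal.rpow_mul,
      one_div_mul_cancel ha.ne', ENNReal.rpow_one, mul_comm]
    congr 1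
    · rw [← lintegral_sub_right_eq_self k x, one_div_mul_eq_div]
      congr 1
      refine lintegral_congr fun y => ?_
      rw [← ENNReal.rpow_mul, one_div_mul_cancel ha'.ne', ENNReal.rpow_one]
    · refine lintegral_congr fun y => ?_
      rw [ENNReal.mul_rpow_of_nonneg _ _ ha.le, ← ENNReal.rpow_mul, one_div_mul_cancel ha.ne',
        ENNReal.rpow_one]
  calc ∫⁻ x, (∫⁻ y, k (y - x) * f y) ^ a
      ≤ ∫⁻ x, (∫⁻ y, k y) ^ (a / a') * ∫⁻ y, k (y - x) * f y ^ a := lintegral_mono hx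
    _ = (∫⁻ y, k y) ^ (a / a') * ∫⁻ x, ∫⁻ y, k (y - x) * f y ^ a := by
        refine lintegral_const_mul'' _ ?_
        refine AEMeasurable.lintegral_prod_right'
          (f := fun z : RN N × RN N => k (z.2 - z.1) * f z.2 ^ a) ?_
        exact (hk.comp (measurable_snd.sub measurable_fst)).aemeasurable.mul
          ((hf.comp_quasiMeasurePreserving Measure.quasiMeasurePreserving_snd).pow_const a)
    _ = (∫⁻ y, k y) ^ (a / a') * ((∫⁻ y, k y) * ∫⁻ y, f y ^ a) := by
        rw [lintegral_lintegral_swap]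
        · congr 1
          have : ∀ y, ∫⁻ x, k (y - x) * f y ^ a = (∫⁻ z, k z) * f y ^ a := by
            intro y
            rw [lintegral_mul_const _ (show Measurable fun x => k (y - x) from
              hk.comp (measurable_const.sub measurable_id)),
              lintegral_sub_left_eq_self k y]
          simp_rw [this]
          rw [lintegral_const_mul'' _ (hf.pow_const a)]
        · exact (hk.comp (measurable_snd.sub measurable_fst)).aemeasurable.mul
            ((hf.comp_quasiMeasurePreserving Measure.quasiMeasurePreserving_snd).pow_const a)
    _ = _ := by
        rw [← mul_assoc]
        congr 1
        nth_rw 2 [← ENNReal.rpow_one (∫⁻ y, k y)]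
        rw [← ENNReal.rpow_add_of_nonneg _ _ (by positivity) zero_le_one]
        congr 1
        have := h.inv_add_inv_eq_one
        have h3 : a / a' = a * (1 - a⁻¹) := by rw [← this]; ring
        rw [h3]
        field_simp
        ring

/-- Elementary interpolation of `L^r` between `L^a` and `L^∞`. -/
theorem lintegral_rpow_le_of_le {α : Type*} [MeasurableSpace α] {μ : Measure α} {h : α → ℝ≥0∞}
    {M : ℝ≥0∞} (hM : ∀ x, h x ≤ M) (hM' : M ≠ ∞) {a r : ℝ} (ha : 0 ≤ a) (har : a ≤ r) :
    ∫⁻ x, h x ^ r ∂μ ≤ M ^ (r - a) * ∫⁻ x, h x ^ a ∂μ := by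
  have hra : 0 ≤ r - a := sub_nonneg.2 har
  have : ∀ x, h x ^ r ≤ M ^ (r - a) * h x ^ a := by
    intro x
    calc h x ^ r = h x ^ (r - a) * h x ^ a := by
          rw [← ENNReal.rpow_add_of_nonneg _ _ hra ha]; ring_nf
      _ ≤ _ := by gcongr; exact hM x
  rw [← lintegral_const_mul' _ _ (ENNReal.rpow_ne_top_of_nonneg hra hM')]
  exact lintegral_mono this

theorem eLpNorm_ofReal_eq {α E : Type*} [MeasurableSpace α] [NormedAddCommGroup E]
    {μ : Measure α} {a : ℝ} (ha : 0 < a) (f : α → E) :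
    eLpNorm f (ENNReal.ofReal a) μ = (∫⁻ x, ‖f x‖ₑ ^ a ∂μ) ^ (1 / a) := by
  rw [eLpNorm_eq_lintegral_rpow_enorm_toReal (by simpa using ha) ENNReal.ofReal_ne_top,
    ENNReal.toReal_ofReal ha.le]

theorem eLpNorm_ofReal_rpow {α E : Type*} [MeasurableSpace α] [NormedAddCommGroup E]
    {μ : Measure α} {a : ℝ} (ha : 0 < a) (f : α → E) :
    eLpNorm f (ENNReal.ofReal a) μ ^ a = ∫⁻ x, ‖f x‖ₑ ^ a ∂μ := by
  rw [eLpNorm_ofReal_eq ha, ← ENNReal.rpow_mul, one_div_mul_cancel ha.ne', ENNReal.rpow_one]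

theorem eLpNorm_ofReal_le_iff {α E : Type*} [MeasurableSpace α] [NormedAddCommGroup E]
    {μ : Measure α} {a : ℝ} (ha : 0 < a) (f : α → E) {C : ℝ≥0∞} :
    eLpNorm f (ENNReal.ofReal a) μ ≤ C ↔ ∫⁻ x, ‖f x‖ₑ ^ a ∂μ ≤ C ^ a := by
  rw [← eLpNorm_ofReal_rpow ha, ENNReal.rpow_le_rpow_iff ha]

/-- The r-th root of `lintegral_rpow_le_of_le`. It turns a uniform bound into Bernstein's
inequality, and uniform convergence into convergence in norm. -/
theorem eLpNorm_ofReal_le_of_le {α E : Type*} [MeasurableSpace α] [NormedAddCommGroup E]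
    {μ : Measure α} {f : α → E} {M : ℝ≥0∞} (hM : ∀ x, ‖f x‖ₑ ≤ M) (hM' : M ≠ ∞) {a r : ℝ}
    (ha : 0 < a) (har : a ≤ r) :
    eLpNorm f (ENNReal.ofReal r) μ ≤
      M ^ (1 - a / r) * eLpNorm f (ENNReal.ofReal a) μ ^ (a / r) := by
  have hr : 0 < r := ha.trans_le har
  rw [eLpNorm_ofReal_le_iff hr, ENNReal.mul_rpow_of_nonneg _ _ hr.le, ← ENNReal.rpow_mul,
    ← ENNReal.rpow_mul, div_mul_cancel₀ _ hr.ne', eLpNorm_ofReal_rpow ha, sub_mul, one_mul,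
    div_mul_cancel₀ _ hr.ne']
  exact lintegral_rpow_le_of_le hM hM' ha.le har

theorem lintegral_enorm_mul_le {α : Type*} [MeasurableSpace α] {μ : Measure α} {a a' : ℝ}
    (h : a.HolderConjugate a') {k : α → ℝ≥0∞} {u : α → ℂ} (hk : AEMeasurable k μ)
    (hu : AEStronglyMeasurable u μ) :
    ∫⁻ y, k y * ‖u y‖ₑ ∂μ ≤
      (∫⁻ y, k y ^ a' ∂μ) ^ (1 / a') * eLpNorm u (ENNReal.ofReal a) μ := by
  rw [eLpNorm_ofReal_eq h.pos]
  exact ENNReal.lintegral_mul_le_Lp_mul_Lq μ h.symm hk hu.enorm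

theorem lintegral_schwartz_rpow_ne_top {N : ℕ} (κ : 𝓢(RN N, ℂ)) {s : ℝ} (hs : 0 < s) :
    ∫⁻ y, ‖κ y‖ₑ ^ s ≠ ∞ := by
  have h := (κ.memLp (ENNReal.ofReal s) volume).eLpNorm_lt_top
  rw [← eLpNorm_ofReal_rpow hs]
  exact ENNReal.rpow_ne_top_of_nonneg hs.le h.ne

/-! ### Averages: norm bounds, Bernstein, local Lipschitz continuity. -/

/-- The average of `u` at `x` against the dilated kernel `dilate l x κ`. -/
noncomputable def smoothing {N : ℕ} (κ : 𝓢(RN N, ℂ)) (l : ℝˣ) (u : RN N → ℂ) (x : RN N) : ℂ :=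
  ∫ y, dilate l x κ y • u y

theorem integrable_dilate_smul {N : ℕ} (κ : 𝓢(RN N, ℂ)) {a : ℝ} (ha : 1 < a) {u : RN N → ℂ}
    (hu : MemLp u (ENNReal.ofReal a)) : Integrable fun y => κ y • u y := by
  have h := Real.HolderConjugate.conjExponent ha
  refine ⟨κ.continuous.aestronglyMeasurable.smul hu.1, ?_⟩
  rw [hasFiniteIntegral_iff_enorm]
  simp_rw [enorm_smul]
  refine (lintegral_enorm_mul_le h κ.continuous.enorm.aemeasurable hu.1).trans_lt ?_
  exact ENNReal.mul_lt_top (ENNReal.rpow_lt_top_of_nonneg (by have := h.symm.pos; positivity)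
    (lintegral_schwartz_rpow_ne_top κ h.symm.pos)) hu.2

theorem enorm_smoothing_le {N : ℕ} (κ : 𝓢(RN N, ℂ)) (l : ℝˣ) (u : RN N → ℂ) (x : RN N) :
    ‖smoothing κ l u x‖ₑ ≤ ∫⁻ y, ‖dilate l x κ y‖ₑ * ‖u y‖ₑ := by
  refine (enorm_integral_le_lintegral_enorm _).trans (le_of_eq ?_)
  simp_rw [enorm_smul]

/-- Pointwise bound for averages of `L^a` functions. -/
theorem enorm_smoothing_le_eLpNorm {N : ℕ} (κ : 𝓢(RN N, ℂ)) {a a' : ℝ}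
    (h : a.HolderConjugate a') (l : ℝˣ) {u : RN N → ℂ} (hu : AEStronglyMeasurable u) (x : RN N) :
    ‖smoothing κ l u x‖ₑ ≤ ENNReal.ofReal ((|(l : ℝ)| ^ N) ^ (1 / a)) *
      (∫⁻ y, ‖κ y‖ₑ ^ a') ^ (1 / a') * eLpNorm u (ENNReal.ofReal a) := by
  have ha' := h.symm.pos
  have hl : 0 < |(l : ℝ)| ^ N := pow_pos (abs_pos.2 l.ne_zero) _
  refine (enorm_smoothing_le κ l u x).trans
    ((lintegral_enorm_mul_le h (dilate l x κ).continuous.enorm.aemeasurable hu).trans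
      (le_of_eq ?_))
  rw [lintegral_dilate_rpow l x κ ha'.le, ENNReal.mul_rpow_of_nonneg _ _ (by positivity),
    ENNReal.ofReal_rpow_of_pos (by positivity), ← Real.rpow_mul hl.le]
  congr 4
  have := h.inv_add_inv_eq_one
  have h3 : 1 / a = 1 - a'⁻¹ := by rw [one_div]; linarith
  rw [h3, sub_mul, one_mul, mul_one_div, div_self ha'.ne', one_div]

/-- Averages are bounded on `L^a`, uniformly in the scale. -/
theorem eLpNorm_smoothing_le {N : ℕ} (κ : 𝓢(RN N, ℂ)) {a : ℝ} (ha : 1 < a) (l : ℝˣ)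
    {u : RN N → ℂ} (hu : AEStronglyMeasurable u) :
    eLpNorm (smoothing κ l u) (ENNReal.ofReal a) ≤
      (∫⁻ y, ‖κ y‖ₑ) * eLpNorm u (ENNReal.ofReal a) := by
  have h := Real.HolderConjugate.conjExponent ha
  rw [eLpNorm_ofReal_le_iff h.pos, ENNReal.mul_rpow_of_nonneg _ _ h.nonneg,
    eLpNorm_ofReal_rpow h.pos]
  have h1 : ∫⁻ y, ‖dilate l 0 κ y‖ₑ = ∫⁻ y, ‖κ y‖ₑ := by
    simpa using lintegral_dilate_rpow l 0 κ zero_le_one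
  rw [← h1]
  refine le_trans (lintegral_mono fun x => ?_) (lintegral_rpow_convolution_le h
    (dilate l 0 κ).continuous.enorm.measurable hu.enorm)
  refine ENNReal.rpow_le_rpow ((enorm_smoothing_le κ l u x).trans (le_of_eq ?_)) h.nonneg
  refine lintegral_congr fun y => ?_
  simp only [dilate_apply, sub_zero]

/-- Bernstein's inequality: averages at scale `1/l` map `L^a` to `L^r`, with the sharp power of
`l`. -/
theorem exists_eLpNorm_smoothing_le {N : ℕ} (κ : 𝓢(RN N, ℂ)) {a r : ℝ} (ha : 1 < a)
    (har : a ≤ r) : ∃ C : ℝ≥0∞, C ≠ ∞ ∧ ∀ (l : ℝˣ) (u : RN N → ℂ),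
      MemLp u (ENNReal.ofReal a) → eLpNorm (smoothing κ l u) (ENNReal.ofReal r) ≤
        ENNReal.ofReal ((|(l : ℝ)| ^ N) ^ (1 / a - 1 / r)) * C * eLpNorm u (ENNReal.ofReal a) := by
  have h := Real.HolderConjugate.conjExponent ha
  set a' := a.conjExponent
  have ha0 := h.pos
  have ha' := h.symm.pos
  have hr : 0 < r := ha0.trans_le har
  have hθ : 0 ≤ 1 - a / r := by rw [sub_nonneg, div_le_one hr]; exact har
  have hA := ENNReal.rpow_ne_top_of_nonneg (show 0 ≤ 1 / a' by positivity)
    (lintegral_schwartz_rpow_ne_top κ ha')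
  have hB : ∫⁻ y, ‖κ y‖ₑ ≠ ∞ := by simpa using lintegral_schwartz_rpow_ne_top κ zero_lt_one
  -- Interpolation of the uniform bound and the `L^a` bound, with weights 1 - a/r and a/r. Only the
  -- former carries a power of l.
  refine ⟨((∫⁻ y, ‖κ y‖ₑ ^ a') ^ (1 / a')) ^ (1 - a / r) * (∫⁻ y, ‖κ y‖ₑ) ^ (a / r),
    ENNReal.mul_ne_top (ENNReal.rpow_ne_top_of_nonneg hθ hA)
      (ENNReal.rpow_ne_top_of_nonneg (by positivity) hB), fun l u hu => ?_⟩
  have hl : 0 < |(l : ℝ)| ^ N := pow_pos (abs_pos.2 l.ne_zero) _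
  refine (eLpNorm_ofReal_le_of_le (enorm_smoothing_le_eLpNorm κ h l hu.1)
    (ENNReal.mul_ne_top (ENNReal.mul_ne_top ENNReal.ofReal_ne_top hA) hu.2.ne) ha0 har).trans ?_
  refine (mul_le_mul_right (ENNReal.rpow_le_rpow (eLpNorm_smoothing_le κ ha l hu.1)
    (by positivity)) _).trans (le_of_eq ?_)
  rw [ENNReal.mul_rpow_of_nonneg _ _ hθ, ENNReal.mul_rpow_of_nonneg _ _ hθ,
    ENNReal.mul_rpow_of_nonneg _ _ (show 0 ≤ a / r by positivity),
    ENNReal.ofReal_rpow_of_pos (by positivity), ← Real.rpow_mul hl.le]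
  have e1 : 1 / a * (1 - a / r) = 1 / a - 1 / r := by field_simp
  have e2 : eLpNorm u (ENNReal.ofReal a) = eLpNorm u (ENNReal.ofReal a) ^ (1 - a / r) *
      eLpNorm u (ENNReal.ofReal a) ^ (a / r) := by
    rw [← ENNReal.rpow_add_of_nonneg _ _ hθ (by positivity), sub_add_cancel, ENNReal.rpow_one]
  rw [e1]
  conv_rhs => rw [e2]
  ring

/-- On balls, averages of `L^a` functions are Lipschitz continuous, uniformly on bounded sets of
`L^a`. -/
theorem exists_enorm_smoothing_sub_le {N : ℕ} (κ : 𝓢(RN N, ℂ)) {a : ℝ} (ha : 1 < a) (l : ℝˣ)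
    {R : ℝ} (hR : 0 ≤ R) : ∃ C : ℝ≥0∞, C ≠ ∞ ∧ ∀ u : RN N → ℂ, MemLp u (ENNReal.ofReal a) →
      ∀ x ∈ Metric.closedBall (0 : RN N) R, ∀ x' ∈ Metric.closedBall (0 : RN N) R,
        ‖smoothing κ l u x - smoothing κ l u x'‖ₑ ≤
          edist x x' * (C * eLpNorm u (ENNReal.ofReal a)) := by
  have h := Real.HolderConjugate.conjExponent ha
  set a' := a.conjExponent
  have ha' := h.symm.pos
  set k : 𝓢(RN N, ℂ) := dilate l 0 κ
  have hk : ∀ x y, dilate l x κ y = k (y - x) := fun x y => by simp [k, dilate_apply]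
  -- Decay of order N + 1 makes the majorant w of the gradient lie in L^{a'}, since (N + 1)a' > N.
  obtain ⟨c, hc0, hc⟩ : ∃ c : ℝ, 0 ≤ c ∧ ∀ z : RN N, (1 + ‖z‖) ^ (N + 1) * ‖fderiv ℝ k z‖ ≤ c := by
    have hc : ∀ z : RN N, _ ≤ _ := SchwartzMap.one_add_le_sup_seminorm_apply (𝕜 := ℝ)
      (m := (N + 1, 1)) (k := N + 1) (n := 1) le_rfl le_rfl k
    refine ⟨_, le_trans (by positivity) (hc 0), fun z => ?_⟩
    rw [← norm_iteratedFDeriv_one]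
    exact hc z
  set w : RN N → ℝ := fun y => c * (1 + R) ^ (N + 1) * (1 + ‖y‖) ^ (-((N : ℝ) + 1))
  have hw : ∀ y x : RN N, ‖x‖ ≤ R → ‖fderiv ℝ k (y - x)‖ ≤ w y := by
    intro y x hx
    have h1 : 1 + ‖y‖ ≤ (1 + R) * (1 + ‖y - x‖) := by
      have : ‖y‖ ≤ ‖y - x‖ + ‖x‖ := by simpa using norm_add_le (y - x) x
      nlinarith [norm_nonneg (y - x)]
    have h2 : (1 + ‖y‖) ^ (N + 1) ≤ (1 + R) ^ (N + 1) * (1 + ‖y - x‖) ^ (N + 1) := by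
      rw [← mul_pow]; gcongr
    have h3 : w y = c * (1 + R) ^ (N + 1) / (1 + ‖y‖) ^ (N + 1) := by
      simp only [w]
      rw [Real.rpow_neg (by positivity), ← Nat.cast_add_one, Real.rpow_natCast, div_eq_mul_inv]
    rw [h3, le_div_iff₀ (by positivity)]
    calc ‖fderiv ℝ k (y - x)‖ * (1 + ‖y‖) ^ (N + 1)
        ≤ ‖fderiv ℝ k (y - x)‖ * ((1 + R) ^ (N + 1) * (1 + ‖y - x‖) ^ (N + 1)) := by gcongr
      _ = (1 + R) ^ (N + 1) * ((1 + ‖y - x‖) ^ (N + 1) * ‖fderiv ℝ k (y - x)‖) := by ring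
      _ ≤ (1 + R) ^ (N + 1) * c := by gcongr; exact hc _
      _ = _ := mul_comm _ _
  have hlip : ∀ y : RN N, ∀ x ∈ Metric.closedBall (0 : RN N) R,
      ∀ x' ∈ Metric.closedBall (0 : RN N) R, ‖k (y - x) - k (y - x')‖ ≤ w y * ‖x - x'‖ := by
    intro y x hx x' hx'
    refine (convex_closedBall (0 : RN N) R).norm_image_sub_le_of_norm_fderiv_le (𝕜 := ℝ)
      (f := fun z => k (y - z)) (fun z _ => ?_) (fun z hz => ?_) hx' hx
    · exact k.differentiableAt.comp z (by fun_prop)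
    · have e : fderiv ℝ (fun z => k (y - z)) z = -fderiv ℝ k (y - z) := by
        have := (k.differentiableAt (x := y - z)).hasFDerivAt.comp z ((hasFDerivAt_id z).const_sub y)
        exact this.fderiv.trans (by ext; simp)
      rw [e, norm_neg]
      exact hw y z (by simpa using hz)
  have hwm : Measurable w := by fun_prop
  have hw0 : ∀ y, 0 ≤ w y := fun y => by positivity
  have hwint : ∫⁻ y, ‖w y‖ₑ ^ a' ≠ ∞ := by
    have e : ∀ y, ‖w y‖ₑ ^ a' = ENNReal.ofReal ((c * (1 + R) ^ (N + 1)) ^ a') *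
        ENNReal.ofReal ((1 + ‖y‖) ^ (-(((N : ℝ) + 1) * a'))) := by
      intro y
      rw [Real.enorm_of_nonneg (hw0 y), ENNReal.ofReal_rpow_of_nonneg (hw0 y) ha'.le,
        ← ENNReal.ofReal_mul (by positivity), ← neg_mul, Real.rpow_mul (by positivity)]
      simp only [w]
      rw [Real.mul_rpow (by positivity) (by positivity)]
    simp_rw [e]
    rw [lintegral_const_mul' _ _ ENNReal.ofReal_ne_top]
    refine ENNReal.mul_ne_top ENNReal.ofReal_ne_top (finite_integral_one_add_norm ?_).ne
    have := h.symm.lt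
    rw [finrank_euclideanSpace_fin]
    nlinarith [(Nat.cast_nonneg N : (0 : ℝ) ≤ N)]
  refine ⟨(∫⁻ y, ‖w y‖ₑ ^ a') ^ (1 / a'), ENNReal.rpow_ne_top_of_nonneg (by positivity) hwint,
    fun u hu x hx x' hx' => ?_⟩
  have e1 : smoothing κ l u x - smoothing κ l u x' = ∫ y, (k (y - x) - k (y - x')) • u y := by
    rw [smoothing, smoothing, ← integral_sub (integrable_dilate_smul _ ha hu)
      (integrable_dilate_smul _ ha hu)]
    simp_rw [hk, sub_smul]
  rw [e1]
  refine (enorm_integral_le_lintegral_enorm _).trans ?_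
  refine le_trans (lintegral_mono (g := fun y => edist x x' * (‖w y‖ₑ * ‖u y‖ₑ)) fun y => ?_) ?_
  · simp only
    rw [enorm_smul, ← mul_assoc]
    gcongr
    rw [edist_eq_enorm_sub, mul_comm, ← enorm_norm (x - x'), ← enorm_mul]
    refine enorm_le_iff_norm_le.2 ?_
    rw [Real.norm_of_nonneg (mul_nonneg (hw0 y) (norm_nonneg _))]
    exact hlip y x hx x' hx'
  · rw [lintegral_const_mul' _ _ (edist_ne_top _ _)]
    gcongr
    exact lintegral_enorm_mul_le h hwm.enorm.aemeasurable hu.1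

/-- The Lipschitz bound on a ball around the origin containing a neighbourhood of x. Continuity
supplies measurability of averages for the weighted measure as well. -/
theorem continuous_smoothing {N : ℕ} (κ : 𝓢(RN N, ℂ)) {a : ℝ} (ha : 1 < a) (l : ℝˣ)
    {u : RN N → ℂ} (hu : MemLp u (ENNReal.ofReal a)) : Continuous (smoothing κ l u) := by
  rw [continuous_iff_continuousAt]
  intro x
  have hR : 0 ≤ ‖x‖ + 1 := by positivity
  obtain ⟨C, hC, h⟩ := exists_enorm_smoothing_sub_le κ ha l hR
  have hx : x ∈ Metric.closedBall (0 : RN N) (‖x‖ + 1) := by simp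
  have hD : C * eLpNorm u (ENNReal.ofReal a) ≠ ∞ := ENNReal.mul_ne_top hC hu.2.ne
  rw [ContinuousAt, tendsto_iff_edist_tendsto_0]
  refine tendsto_of_tendsto_of_tendsto_of_le_of_le' tendsto_const_nhds
    (h := fun z => edist z x * (C * eLpNorm u (ENNReal.ofReal a))) ?_
    (Eventually.of_forall fun _ => zero_le) ?_
  · have h1 : Tendsto (fun z => edist z x) (𝓝 x) (𝓝 0) := tendsto_iff_edist_tendsto_0.1 tendsto_id
    simpa using ENNReal.Tendsto.mul_const h1 (Or.inr hD)
  · filter_upwards [Metric.closedBall_mem_nhds x one_pos] with z hz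
    rw [edist_eq_enorm_sub (smoothing κ l u z)]
    refine h u hu z ?_ x hx
    rw [mem_closedBall_iff_norm] at hz
    rw [mem_closedBall_zero_iff]
    have : ‖z‖ ≤ ‖z - x‖ + ‖x‖ := by simpa using norm_add_le (z - x) x
    linarith

/-! ### Convergence of averages in L^a. -/

/-- Total mass is the Fourier transform at frequency zero, where neither the phase nor the rescaling
acts. -/
theorem integral_dilate {N : ℕ} (l : ℝˣ) (x : RN N) (κ : 𝓢(RN N, ℂ)) :
    ∫ y, dilate l x κ y = ∫ y, κ y := by
  have h := fourier_dilate l x κ 0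
  rw [fourier_coe, fourier_coe, Real.fourier_eq, Real.fourier_eq] at h
  simpa using h

theorem smoothing_sub {N : ℕ} (κ : 𝓢(RN N, ℂ)) {a : ℝ} (ha : 1 < a) (l : ℝˣ) {u v : RN N → ℂ}
    (hu : MemLp u (ENNReal.ofReal a)) (hv : MemLp v (ENNReal.ofReal a)) :
    smoothing κ l (u - v) = smoothing κ l u - smoothing κ l v := by
  ext x
  simp only [smoothing, Pi.sub_apply, smul_sub]
  exact integral_sub (integrable_dilate_smul _ ha hu) (integrable_dilate_smul _ ha hv)

/-- Averages of a Schwartz function converge uniformly, at the rate of the scale. -/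
theorem exists_enorm_smoothing_sub_self_le {N : ℕ} (κ : 𝓢(RN N, ℂ)) (hκ : ∫ y, κ y = 1)
    (f : 𝓢(RN N, ℂ)) : ∃ C : ℝ≥0∞, C ≠ ∞ ∧ ∀ (l : ℝˣ) (x : RN N),
      ‖smoothing κ l f x - f x‖ₑ ≤ ENNReal.ofReal |(l : ℝ)|⁻¹ * C := by
  obtain ⟨M, hM⟩ : ∃ M : ℝ, ∀ z : RN N, ‖fderiv ℝ f z‖ ≤ M := by
    obtain ⟨M, hM⟩ := f.decay 0 1
    exact ⟨M, fun z => by simpa [norm_iteratedFDeriv_one] using hM.2 z⟩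
  have hM0 : 0 ≤ M := (norm_nonneg _).trans (hM 0)
  have hlip : ∀ x y, ‖f y - f x‖ ≤ M * ‖y - x‖ := fun x y =>
    convex_univ.norm_image_sub_le_of_norm_fderiv_le (𝕜 := ℝ) (fun z _ => f.differentiableAt)
      (fun z _ => hM z) (Set.mem_univ x) (Set.mem_univ y)
  set F : RN N → ℝ≥0∞ := fun z => ENNReal.ofReal (‖z‖ * ‖κ z‖)
  have hF : ∫⁻ z, F z ≠ ∞ := by
    have := (κ.integrable_pow_mul volume 1).hasFiniteIntegral
    simp only [pow_one] at this
    rw [hasFiniteIntegral_iff_norm] at this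
    refine ne_of_lt (lt_of_le_of_lt (lintegral_mono fun z => ?_) this)
    exact ENNReal.ofReal_le_ofReal (le_abs_self _)
  refine ⟨ENNReal.ofReal M * ∫⁻ z, F z, ENNReal.mul_ne_top ENNReal.ofReal_ne_top hF,
    fun l x => ?_⟩
  have hl : 0 < |(l : ℝ)| := abs_pos.2 l.ne_zero
  have hf : MemLp f (ENNReal.ofReal 2) := f.memLp _ _
  have e1 : smoothing κ l f x - f x = ∫ y, dilate l x κ y • (f y - f x) := by
    have h1 : ∫ y, dilate l x κ y • f x = f x := by
      rw [integral_smul_const, integral_dilate, hκ, one_smul]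
    simp_rw [smul_sub]
    rw [integral_sub (integrable_dilate_smul _ one_lt_two hf)
      ((dilate l x κ).integrable.smul_const _), h1, smoothing]
  rw [e1]
  refine (enorm_integral_le_lintegral_enorm _).trans ?_
  -- Writing |y - x| = |l|⁻¹ |l(y - x)| extracts the rate |l|⁻¹ and leaves the first moment of κ.
  have hpt : ∀ y, ‖dilate l x κ y • (f y - f x)‖ₑ ≤
      ENNReal.ofReal (|(l : ℝ)| ^ N * |(l : ℝ)|⁻¹ * M) * (fun z => F ((l : ℝ) • z)) (y - x) := by
    intro y
    simp only [F]
    rw [← ofReal_norm, ← ENNReal.ofReal_mul (by positivity)]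
    refine ENNReal.ofReal_le_ofReal ?_
    rw [norm_smul, dilate_apply, norm_smul, norm_smul, norm_pow, norm_abs_eq_norm,
      ← Real.norm_eq_abs]
    rw [← Real.norm_eq_abs] at hl
    calc ‖(l : ℝ)‖ ^ N * ‖κ ((l : ℝ) • (y - x))‖ * ‖f y - f x‖
        ≤ ‖(l : ℝ)‖ ^ N * ‖κ ((l : ℝ) • (y - x))‖ * (M * ‖y - x‖) := by gcongr; exact hlip x y
      _ = _ := by field_simp
  refine (lintegral_mono hpt).trans (le_of_eq ?_)
  rw [lintegral_const_mul' _ _ ENNReal.ofReal_ne_top,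
    lintegral_sub_right_eq_self (fun z => F ((l : ℝ) • z)) x,
    lintegral_comp_smul_eq F l.ne_zero, ← mul_assoc, ← mul_assoc, ← ENNReal.ofReal_mul (by positivity),
    ← ENNReal.ofReal_mul (by positivity)]
  congr 2
  field_simp

/-- The unit `2 ^ k` of `ℝ`. -/
noncomputable def twoPow (k : ℕ) : ℝˣ := Units.mk0 ((2 : ℝ) ^ k) (by positivity)

theorem coe_twoPow (k : ℕ) : (twoPow k : ℝ) = 2 ^ k := rfl

/-- Convergence is uniform, and the errors are bounded in L^{a₀} for an a₀ strictly between 1 and a.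
Interpolation gives convergence in L^a. -/
theorem tendsto_eLpNorm_smoothing_schwartz {N : ℕ} (κ : 𝓢(RN N, ℂ)) (hκ : ∫ y, κ y = 1) {a : ℝ}
    (ha : 1 < a) (f : 𝓢(RN N, ℂ)) :
    Tendsto (fun k => eLpNorm (smoothing κ (twoPow k) f - ⇑f) (ENNReal.ofReal a)) atTop (𝓝 0) := by
  obtain ⟨C, hC, h⟩ := exists_enorm_smoothing_sub_self_le κ hκ f
  set a₀ := (1 + a) / 2
  have h1 : 1 < a₀ := by simp only [a₀]; linarith
  have h2 : a₀ < a := by simp only [a₀]; linarith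
  have hB : ∫⁻ y, ‖κ y‖ₑ ≠ ∞ := by simpa using lintegral_schwartz_rpow_ne_top κ zero_lt_one
  have hθ : 0 < 1 - a₀ / a := by rw [sub_pos, div_lt_one (by linarith)]; exact h2
  have hf : MemLp f (ENNReal.ofReal a₀) := f.memLp _ _
  set D := (∫⁻ y, ‖κ y‖ₑ) * eLpNorm f (ENNReal.ofReal a₀) + eLpNorm f (ENNReal.ofReal a₀)
  have hD : D ≠ ∞ := ENNReal.add_ne_top.2 ⟨ENNReal.mul_ne_top hB hf.2.ne, hf.2.ne⟩
  have hbound : ∀ k, eLpNorm (smoothing κ (twoPow k) f - ⇑f) (ENNReal.ofReal a) ≤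
      (ENNReal.ofReal ((2 : ℝ)⁻¹ ^ k) * C) ^ (1 - a₀ / a) * D ^ (a₀ / a) := by
    intro k
    have hs : ∀ x, ‖(smoothing κ (twoPow k) f - ⇑f) x‖ₑ ≤ ENNReal.ofReal ((2 : ℝ)⁻¹ ^ k) * C := by
      intro x
      have := h (twoPow k) x
      rwa [coe_twoPow, abs_of_pos (by positivity), ← inv_pow] at this
    refine (eLpNorm_ofReal_le_of_le hs (ENNReal.mul_ne_top ENNReal.ofReal_ne_top hC)
      (by linarith) h2.le).trans ?_
    gcongr
    refine (eLpNorm_sub_le (continuous_smoothing κ h1 _ hf).aestronglyMeasurable hf.1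
      (by simpa using h1.le)).trans ?_
    simp only [D]
    gcongr
    exact eLpNorm_smoothing_le κ h1 _ hf.1
  refine tendsto_of_tendsto_of_tendsto_of_le_of_le tendsto_const_nhds ?_ (fun _ => zero_le) hbound
  have t1 : Tendsto (fun k : ℕ => ENNReal.ofReal ((2 : ℝ)⁻¹ ^ k)) atTop (𝓝 0) := by
    rw [← ENNReal.ofReal_zero]
    exact ENNReal.tendsto_ofReal (tendsto_pow_atTop_nhds_zero_of_lt_one (by norm_num) (by norm_num))
  have t2 := ENNReal.Tendsto.mul_const t1 (Or.inr hC)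
  have t3 := (ENNReal.continuous_rpow_const (y := 1 - a₀ / a)).tendsto _ |>.comp t2
  have t4 := ENNReal.Tendsto.mul_const t3 (Or.inr
    (ENNReal.rpow_ne_top_of_nonneg (show 0 ≤ a₀ / a by positivity) hD))
  simpa [ENNReal.zero_rpow_of_pos hθ] using t4

theorem eLpNorm_add_sub_le {α : Type*} [MeasurableSpace α] {μ : Measure α} {f g h : α → ℂ}
    (hf : AEStronglyMeasurable f μ) (hg : AEStronglyMeasurable g μ)
    (hh : AEStronglyMeasurable h μ) {r : ℝ≥0∞} (hr : 1 ≤ r) :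
    eLpNorm (f + g - h) r μ ≤ eLpNorm f r μ + eLpNorm g r μ + eLpNorm h r μ := by
  refine (eLpNorm_sub_le (hf.add hg) hh hr).trans ?_
  gcongr
  exact eLpNorm_add_le hf hg hr

/-- Averages against a kernel of mass one converge in `L^a`. -/
theorem tendsto_eLpNorm_smoothing {N : ℕ} (κ : 𝓢(RN N, ℂ)) (hκ : ∫ y, κ y = 1) {a : ℝ}
    (ha : 1 < a) {u : RN N → ℂ} (hu : MemLp u (ENNReal.ofReal a)) :
    Tendsto (fun k => eLpNorm (smoothing κ (twoPow k) u - u) (ENNReal.ofReal a)) atTop (𝓝 0) := by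
  have ha1 : 1 ≤ ENNReal.ofReal a := by simpa using ha.le
  have : Fact (1 ≤ ENNReal.ofReal a) := ⟨ha1⟩
  set A := ∫⁻ y, ‖κ y‖ₑ
  have hA : A ≠ ∞ := by simpa [A] using lintegral_schwartz_rpow_ne_top κ zero_lt_one
  rw [ENNReal.tendsto_nhds_zero]
  intro ε hε
  -- The approximation error z enters twice, as A z after averaging and as z itself; A + 1 absorbs
  -- both.
  have hδ : 0 < ε / 2 / (A + 1) :=
    ENNReal.div_pos (ENNReal.half_pos hε.ne').ne' (ENNReal.add_ne_top.2 ⟨hA, ENNReal.one_ne_top⟩)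
  obtain ⟨f, hf⟩ : ∃ f : 𝓢(RN N, ℂ), eLpNorm (u - ⇑f) (ENNReal.ofReal a) < ε / 2 / (A + 1) := by
    obtain ⟨_, ⟨f, rfl⟩, hf⟩ := EMetric.mem_closure_iff.1 (SchwartzMap.denseRange_toLpCLM (F := ℂ)
      (μ := (volume : Measure (RN N))) (p := ENNReal.ofReal a) ENNReal.ofReal_ne_top
      (hu.toLp u)) _ hδ
    refine ⟨f, ?_⟩
    rw [Lp.edist_def] at hf
    refine lt_of_le_of_lt (le_of_eq (eLpNorm_congr_ae ?_)) hf
    exact (hu.coeFn_toLp.sub (f.coeFn_toLp _ _)).symm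
  have hfm : MemLp f (ENNReal.ofReal a) := f.memLp _ _
  filter_upwards [ENNReal.tendsto_nhds_zero.1 (tendsto_eLpNorm_smoothing_schwartz κ hκ ha f) (ε / 2)
    (ENNReal.half_pos hε.ne')] with k hk
  have e : smoothing κ (twoPow k) u - u =
      (smoothing κ (twoPow k) (u - ⇑f) + (smoothing κ (twoPow k) f - ⇑f)) - (u - ⇑f) := by
    rw [smoothing_sub κ ha _ hu hfm]
    abel
  have m1 := (continuous_smoothing κ ha (twoPow k) (hu.sub hfm)).aestronglyMeasurable (μ := volume)
  have m2 := ((continuous_smoothing κ ha (twoPow k) hfm).aestronglyMeasurable (μ := volume)).sub hfm.1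
  have c1 := eLpNorm_add_sub_le m1 m2 (hu.sub hfm).1 ha1
  rw [← e] at c1
  have c2 := eLpNorm_smoothing_le κ ha (twoPow k) (hu.sub hfm).1
  refine c1.trans ((add_le_add (add_le_add c2 hk) le_rfl).trans ?_)
  generalize eLpNorm (u - ⇑f) (ENNReal.ofReal a) volume = z at hf
  calc A * z + ε / 2 + z = (A + 1) * z + ε / 2 := by ring
    _ ≤ (A + 1) * (ε / 2 / (A + 1)) + ε / 2 := by gcongr
    _ ≤ ε / 2 + ε / 2 := by gcongr; exact ENNReal.mul_div_le
    _ = ε := ENNReal.add_halves ε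

/-! ### Geometric decay of the high-frequency remainder. -/

/-- A sequence converging in one `L^a` whose increments decay geometrically in `L^r` converges
geometrically in `L^r`. -/
theorem eLpNorm_sub_le_of_geometric {α : Type*} [MeasurableSpace α] {μ : Measure α}
    {f : ℕ → α → ℂ} {u : α → ℂ} (hf : ∀ k, AEStronglyMeasurable (f k) μ)
    (hu : AEStronglyMeasurable u μ) {a r : ℝ≥0∞} (ha : a ≠ 0) (hr : 1 ≤ r)
    (hlim : Tendsto (fun k => eLpNorm (f k - u) a μ) atTop (𝓝 0)) {D ρ : ℝ≥0∞}
    (hD : ∀ k, eLpNorm (f (k + 1) - f k) r μ ≤ ρ ^ k * D) (k : ℕ) :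
    eLpNorm (u - f k) r μ ≤ ρ ^ k * ((1 - ρ)⁻¹ * D) := by
  have hsum : ∀ n, eLpNorm (f (k + n) - f k) r μ ≤ ρ ^ k * ((∑ i ∈ Finset.range n, ρ ^ i) * D) := by
    intro n
    induction n with
    | zero => simp
    | succ n ih =>
      have e : f (k + (n + 1)) - f k = (f (k + n + 1) - f (k + n)) + (f (k + n) - f k) := by
        rw [add_assoc]; abel
      rw [e]
      refine (eLpNorm_add_le ((hf _).sub (hf _)) ((hf _).sub (hf _)) hr).trans ?_
      refine (add_le_add (hD (k + n)) ih).trans (le_of_eq ?_)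
      rw [Finset.sum_range_succ, pow_add]
      ring
  have hsum' : ∀ n, eLpNorm (f (k + n) - f k) r μ ≤ ρ ^ k * ((1 - ρ)⁻¹ * D) := by
    intro n
    refine (hsum n).trans ?_
    rw [← ENNReal.tsum_geometric]
    gcongr
    exact ENNReal.sum_le_tsum _
  -- The limit is known only in L^a. An almost everywhere convergent subsequence and Fatou's lemma
  -- carry the L^r bound over to it.
  obtain ⟨ns, hns, hae⟩ := (tendstoInMeasure_of_tendsto_eLpNorm ha hf hu hlim).exists_seq_tendsto_ae
  refine (Lp.eLpNorm_lim_le_liminf_eLpNorm (f := fun j => f (ns j) - f k)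
    (fun j => (hf _).sub (hf _)) (u - f k) ?_).trans ?_
  · filter_upwards [hae] with x hx
    exact hx.sub tendsto_const_nhds
  · refine liminf_le_of_frequently_le' (Eventually.frequently ?_)
    filter_upwards [hns.tendsto_atTop.eventually_ge_atTop k] with j hj
    obtain ⟨n, hn⟩ := Nat.exists_eq_add_of_le hj
    rw [hn]
    exact hsum' n

/-- The Littlewood–Paley increments of `u` are averages of `D² u`. -/
theorem smoothing_sub_smoothing {N : ℕ} {p : ℝ} (hp : 1 < p) [Fact (1 ≤ ENNReal.ofReal p)]
    {κ E : 𝓢(RN N, ℂ)} {l m : ℝˣ}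
    (h : ∀ x : RN N, dilate l x E ∈ dotSchwartz N ∧
      -(Δ (dilate l x E)) = ((l : ℝ) ^ 2) • (dilate m x κ - dilate l x κ))
    (w : HdotTwoInterLp N (ENNReal.ofReal p)) :
    smoothing κ m w.1.1 - smoothing κ l w.1.1 = (((l : ℝ) ^ 2)⁻¹) • smoothing E l w.1.2 := by
  ext x
  have hl : (l : ℝ) ^ 2 ≠ 0 := pow_ne_zero _ l.ne_zero
  -- The relation defining D²u is tested against the dilated kernel E centred at x.
  have h1 := w.2 _ (h x).1
  rw [(h x).2, Lp.toTemperedDistribution_apply, Lp.toTemperedDistribution_apply] at h1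
  have h2 : ∫ y, (((l : ℝ) ^ 2) • (dilate m x κ - dilate l x κ)) y • w.1.1 y =
      ((l : ℝ) ^ 2) • (smoothing κ m w.1.1 x - smoothing κ l w.1.1 x) := by
    rw [smoothing, smoothing, ← integral_sub (integrable_dilate_smul _ hp (Lp.memLp w.1.1))
      (integrable_dilate_smul _ hp (Lp.memLp w.1.1)), ← integral_smul]
    refine integral_congr_ae (Eventually.of_forall fun y => ?_)
    simp only [smul_apply, sub_apply]
    rw [smul_assoc, sub_smul]
  rw [h2] at h1
  simp only [Pi.sub_apply, Pi.smul_apply]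
  change _ = ((l : ℝ) ^ 2)⁻¹ • ∫ y, dilate l x E y • w.1.2 y
  rw [← h1, inv_smul_smul₀ hl]

/-- Convergence of the Littlewood–Paley averages in `L^r` for subcritical `r`, uniformly on bounded
subsets of the homogeneous Sobolev space. -/
theorem exists_eLpNorm_sub_smoothing_le {N : ℕ} {κ E : 𝓢(RN N, ℂ)} (hκ : ∫ y, κ y = 1)
    (hE : ∀ (l m : ℝˣ) (x : RN N), (m : ℝ) = 2 * l → dilate l x E ∈ dotSchwartz N ∧
      -(Δ (dilate l x E)) = ((l : ℝ) ^ 2) • (dilate m x κ - dilate l x κ))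
    {r : ℝ} (hr : 2 ≤ r) (hrN : N * (1 / 2 - 1 / r) < 2) {p : ℝ} (hp : 1 < p)
    [Fact (1 ≤ ENNReal.ofReal p)] : ∃ C ρ : ℝ≥0∞, C ≠ ∞ ∧ ρ < 1 ∧
      ∀ (w : HdotTwoInterLp N (ENNReal.ofReal p)) (k : ℕ),
        eLpNorm ((w.1.1 : RN N → ℂ) - smoothing κ (twoPow k) w.1.1) (ENNReal.ofReal r) ≤
          ρ ^ k * (C * eLpNorm w.1.2 2) := by
  obtain ⟨C, hC, h⟩ := exists_eLpNorm_smoothing_le E one_lt_two hr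
  -- Per dyadic step, Bernstein from L² to L^r costs 2^{N(1/2-1/r)} and inverting -Δ gains 2^{-2};
  -- subcriticality is exactly ρ < 1.
  set ρ : ℝ≥0∞ := ENNReal.ofReal ((2 : ℝ) ^ (N * (1 / 2 - 1 / r) - 2))
  have hρ : ρ < 1 := by
    rw [← ENNReal.ofReal_one]
    exact (ENNReal.ofReal_lt_ofReal_iff one_pos).2
      (Real.rpow_lt_one_of_one_lt_of_neg one_lt_two (by linarith))
  refine ⟨(1 - ρ)⁻¹ * C, ρ, ENNReal.mul_ne_top (ENNReal.inv_ne_top.2 (tsub_pos_of_lt hρ).ne') hC,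
    hρ, fun w k => ?_⟩
  have hmem : MemLp w.1.1 (ENNReal.ofReal p) := Lp.memLp w.1.1
  rw [mul_assoc]
  refine eLpNorm_sub_le_of_geometric
    (fun j => (continuous_smoothing κ hp (twoPow j) hmem).aestronglyMeasurable)
    hmem.1 (a := ENNReal.ofReal p) (by simpa using hp.le.trans_lt' one_pos) ?_
    (tendsto_eLpNorm_smoothing κ hκ hp hmem) (fun j => ?_) k
  · rw [← ENNReal.ofReal_one]; exact ENNReal.ofReal_le_ofReal (by linarith)
  · rw [smoothing_sub_smoothing hp (fun x => hE (twoPow j) (twoPow (j + 1)) x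
      (by simp only [coe_twoPow, pow_succ]; ring)) w, eLpNorm_const_smul]
    have h3 := h (twoPow j) w.1.2 (by rw [ENNReal.ofReal_ofNat]; exact Lp.memLp w.1.2)
    rw [ENNReal.ofReal_ofNat] at h3
    refine (mul_le_mul_right h3 _).trans (le_of_eq ?_)
    rw [← mul_assoc, ← mul_assoc, ← mul_assoc]
    congr 2
    rw [Real.enorm_of_nonneg (by positivity), ← ENNReal.ofReal_mul (by positivity), coe_twoPow,
      ← ENNReal.ofReal_pow (by positivity)]
    congr 1
    rw [abs_of_pos (by positivity), ← Real.rpow_natCast, ← Real.rpow_natCast, ← Real.rpow_natCast,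
      ← Real.rpow_natCast, ← Real.rpow_neg_one, ← Real.rpow_mul (by positivity),
      ← Real.rpow_mul (by positivity), ← Real.rpow_mul (by positivity),
      ← Real.rpow_mul (by positivity), ← Real.rpow_mul (by positivity),
      ← Real.rpow_add (by positivity)]
    congr 1
    push_cast
    ring

/-! ### The power weight. -/

/-- In polar coordinates the radial integrand is y^{N-1-c}, integrable at 0 when c < N. -/
theorem lintegral_ball_norm_rpow_lt_top {N : ℕ} (hN : 1 ≤ N) {c : ℝ} (hc : c < N) :
    ∫⁻ x in Metric.ball (0 : RN N) 1, ENNReal.ofReal (‖x‖ ^ (-c)) < ∞ := by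
  have : Nonempty (Fin N) := ⟨⟨0, hN⟩⟩
  have h : IntegrableOn (fun x : RN N => ‖x‖ ^ (-c)) (Metric.ball (0 : RN N) 1) := by
    rw [integrableOn_fun_norm_addHaar volume (f := fun y => y ^ (-c)), finrank_euclideanSpace_fin]
    have h1 : IntegrableOn (fun y : ℝ => y ^ ((N : ℝ) - 1 - c)) (Set.Ioo 0 1) := by
      rw [intervalIntegral.integrableOn_Ioo_rpow_iff one_pos]
      linarith
    refine h1.congr_fun (fun y hy => ?_) measurableSet_Ioo
    simp only [smul_eq_mul]
    rw [← Real.rpow_natCast, ← Real.rpow_add hy.1, Nat.cast_sub hN, Nat.cast_one, sub_eq_add_neg _ c]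
  have h2 := h.hasFiniteIntegral
  rw [hasFiniteIntegral_iff_ofReal (Eventually.of_forall fun x => by positivity)] at h2
  exact h2

/-- Since 1 + |x| ≤ 2|x| off the unit ball, comparison with (1 + |x|)^{-c} suffices. -/
theorem lintegral_compl_ball_norm_rpow_lt_top {N : ℕ} {c : ℝ} (hc : N < c) :
    ∫⁻ x in (Metric.ball (0 : RN N) 1)ᶜ, ENNReal.ofReal (‖x‖ ^ (-c)) < ∞ := by
  have hc0 : 0 < c := (Nat.cast_nonneg N).trans_lt hc
  have h := finite_integral_one_add_norm (μ := (volume : Measure (RN N))) (r := c)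
    (by rwa [finrank_euclideanSpace_fin])
  have h1 : ∀ x ∈ (Metric.ball (0 : RN N) 1)ᶜ, ENNReal.ofReal (‖x‖ ^ (-c)) ≤
      ENNReal.ofReal (2 ^ c) * ENNReal.ofReal ((1 + ‖x‖) ^ (-c)) := by
    intro x hx
    have hx1 : 1 ≤ ‖x‖ := by simpa using hx
    rw [← ENNReal.ofReal_mul (by positivity)]
    refine ENNReal.ofReal_le_ofReal ?_
    have h2 : (2 * ‖x‖) ^ (-c) ≤ (1 + ‖x‖) ^ (-c) :=
      Real.rpow_le_rpow_of_nonpos (by positivity) (by linarith) (by linarith)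
    calc ‖x‖ ^ (-c) = 2 ^ c * (2 * ‖x‖) ^ (-c) := by
          rw [Real.mul_rpow (by norm_num) (by positivity), ← mul_assoc, ← Real.rpow_add two_pos]
          simp
      _ ≤ _ := by gcongr
  calc _ ≤ ∫⁻ x in (Metric.ball (0 : RN N) 1)ᶜ,
        ENNReal.ofReal (2 ^ c) * ENNReal.ofReal ((1 + ‖x‖) ^ (-c)) :=
        setLIntegral_mono' Metric.isOpen_ball.measurableSet.compl h1
    _ ≤ ∫⁻ x, ENNReal.ofReal (2 ^ c) * ENNReal.ofReal ((1 + ‖x‖) ^ (-c)) := setLIntegral_le_lintegral _ _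
    _ < ∞ := by
        rw [lintegral_const_mul' _ _ ENNReal.ofReal_ne_top]
        exact ENNReal.mul_lt_top ENNReal.ofReal_lt_top h

theorem weightedVolume_ac {N : ℕ} (b : ℝ) : weightedVolume N b ≪ volume :=
  withDensity_absolutelyContinuous _ _

theorem measurable_norm_rpow {N : ℕ} (b : ℝ) :
    Measurable fun x : RN N => ENNReal.ofReal (‖x‖ ^ (-b)) := by fun_prop

/-- The density can vanish only at the origin, a null set as N ≥ 1. This transfers the
identification of the image with u to Lebesgue measure. -/
theorem ac_weightedVolume {N : ℕ} (hN : 1 ≤ N) (b : ℝ) : volume ≪ weightedVolume N b := by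
  have : Nonempty (Fin N) := ⟨⟨0, hN⟩⟩
  refine withDensity_absolutelyContinuous' (measurable_norm_rpow b).aemeasurable ?_
  have h0 : ∀ᵐ x : RN N, x ≠ 0 := by simp [ae_iff]
  filter_upwards [h0] with x hx
  have := norm_pos_iff.2 hx
  simp only [ne_eq, ENNReal.ofReal_eq_zero, not_le]
  positivity

/-- Hölder's inequality for the weight `|x|^{-b}` on a measurable set. -/
theorem eLpNorm_weightedVolume_restrict_le {N : ℕ} {b q r s : ℝ} (hq : 0 < q)
    (hs : (r / q).HolderConjugate s) {A : Set (RN N)} (hA : MeasurableSet A) {f : RN N → ℂ}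
    (hf : AEStronglyMeasurable f) :
    eLpNorm f (ENNReal.ofReal q) ((weightedVolume N b).restrict A) ≤
      ((∫⁻ x in A, ENNReal.ofReal (‖x‖ ^ (-(b * s)))) ^ (1 / s)) ^ (1 / q) *
        eLpNorm f (ENNReal.ofReal r) := by
  have hr : 0 < r := by
    have := mul_pos hs.pos hq
    rwa [div_mul_cancel₀ _ hq.ne'] at this
  have hs0 := hs.symm.pos
  rw [eLpNorm_ofReal_le_iff hq, ENNReal.mul_rpow_of_nonneg _ _ hq.le, ← ENNReal.rpow_mul,
    one_div_mul_cancel hq.ne', ENNReal.rpow_one, weightedVolume, restrict_withDensity hA,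
    lintegral_withDensity_eq_lintegral_mul₀ (measurable_norm_rpow b).aemeasurable
      (hf.restrict.enorm.pow_const q)]
  refine (ENNReal.lintegral_mul_le_Lp_mul_Lq (volume.restrict A) hs.symm
    (measurable_norm_rpow b).aemeasurable (hf.restrict.enorm.pow_const q)).trans ?_
  refine mul_le_mul' (le_of_eq ?_) ?_
  · congr 1
    refine lintegral_congr fun x => ?_
    rw [ENNReal.ofReal_rpow_of_nonneg (by positivity) hs0.le, ← Real.rpow_mul (norm_nonneg _),
      neg_mul]
  · rw [eLpNorm_ofReal_eq hr, ← ENNReal.rpow_mul, one_div_div, one_div_mul_eq_div]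
    refine ENNReal.rpow_le_rpow ?_ (by positivity)
    refine (setLIntegral_le_lintegral _ _).trans (le_of_eq (lintegral_congr fun x => ?_))
    rw [← ENNReal.rpow_mul, mul_div_cancel₀ _ hq.ne']

theorem eLpNorm_le_restrict_add_restrict_compl {α : Type*} [MeasurableSpace α] {μ : Measure α}
    {f : α → ℂ} (hf : AEStronglyMeasurable f μ) {A : Set α} (hA : MeasurableSet A) {q : ℝ≥0∞}
    (hq : 1 ≤ q) :
    eLpNorm f q μ ≤ eLpNorm f q (μ.restrict A) + eLpNorm f q (μ.restrict Aᶜ) := by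
  rw [← eLpNorm_indicator_eq_eLpNorm_restrict hA, ← eLpNorm_indicator_eq_eLpNorm_restrict hA.compl]
  conv_lhs => rw [← Set.indicator_self_add_compl A f]
  exact eLpNorm_add_le (hf.indicator hA) (hf.indicator hA.compl) hq

/-- The Hölder conjugate of `r / q` when `q < r`, together with its reciprocal. -/
theorem holderConjugate_div {q r : ℝ} (hq : 0 < q) (hqr : q < r) :
    (r / q).HolderConjugate (r / q).conjExponent ∧ 1 / (r / q).conjExponent = 1 - q / r := by
  have h := Real.HolderConjugate.conjExponent ((one_lt_div hq).2 hqr)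
  refine ⟨h, ?_⟩
  have := h.inv_add_inv_eq_one
  rw [inv_div] at this
  rw [one_div]
  linarith

/-- The weighted norm is controlled by a slightly larger exponent near the origin and a slightly
smaller one away from it. -/
theorem exists_eLpNorm_weightedVolume_le {N : ℕ} (hN : 1 ≤ N) {b q r₁ r₂ : ℝ}
    (hq : 1 ≤ q) (h₁ : q < r₁) (h₂ : q < r₂) (hr₁ : q / r₁ < 1 - b / N)
    (hr₂ : 1 - b / N < q / r₂) : ∃ C : ℝ≥0∞, C ≠ ∞ ∧ ∀ f : RN N → ℂ, AEStronglyMeasurable f →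
      eLpNorm f (ENNReal.ofReal q) (weightedVolume N b) ≤
        C * (eLpNorm f (ENNReal.ofReal r₁) + eLpNorm f (ENNReal.ofReal r₂)) := by
  have hq0 : 0 < q := one_pos.trans_le hq
  have hN0 : (0 : ℝ) < N := by exact_mod_cast hN
  obtain ⟨hs₁, e₁⟩ := holderConjugate_div hq0 h₁
  obtain ⟨hs₂, e₂⟩ := holderConjugate_div hq0 h₂
  set s₁ := (r₁ / q).conjExponent
  set s₂ := (r₂ / q).conjExponent
  have p₁ := hs₁.symm.pos
  have p₂ := hs₂.symm.pos
  -- As 1/s₁ = 1 - q/r₁, the assumption on r₁ is the integrability condition for the weight at the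
  -- origin; likewise r₂ at infinity.
  have c₁ : b * s₁ < N := by
    have : b / N < 1 / s₁ := by rw [e₁]; linarith
    rwa [div_lt_div_iff₀ hN0 p₁, one_mul] at this
  have c₂ : N < b * s₂ := by
    have : 1 / s₂ < b / N := by rw [e₂]; linarith
    rwa [div_lt_div_iff₀ p₂ hN0, one_mul] at this
  have hB := (Metric.isOpen_ball (x := (0 : RN N)) (ε := 1)).measurableSet
  have d₁ := ENNReal.rpow_ne_top_of_nonneg (show 0 ≤ 1 / q by positivity)
    (ENNReal.rpow_ne_top_of_nonneg (show 0 ≤ 1 / s₁ by positivity)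
      (lintegral_ball_norm_rpow_lt_top hN c₁).ne)
  have d₂ := ENNReal.rpow_ne_top_of_nonneg (show 0 ≤ 1 / q by positivity)
    (ENNReal.rpow_ne_top_of_nonneg (show 0 ≤ 1 / s₂ by positivity)
      (lintegral_compl_ball_norm_rpow_lt_top c₂).ne)
  refine ⟨_, ENNReal.add_ne_top.2 ⟨d₁, d₂⟩, fun f hf => ?_⟩
  refine (eLpNorm_le_restrict_add_restrict_compl (hf.mono_ac (weightedVolume_ac b)) hB
    (by simpa using hq)).trans ((add_le_add
      (eLpNorm_weightedVolume_restrict_le hq0 hs₁ hB hf)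
      (eLpNorm_weightedVolume_restrict_le hq0 hs₂ hB.compl hf)).trans ?_)
  rw [mul_add]
  gcongr
  · exact le_self_add
  · exact le_add_self

/-- The weighted norm over the exterior of a large ball is small. -/
theorem exists_eLpNorm_weightedVolume_restrict_compl_le {N : ℕ} (hN : 1 ≤ N) {b q r : ℝ}
    (hq : 0 < q) (hqr : q < r) (hr : 1 - b / N < q / r) {ε : ℝ≥0∞} (hε : 0 < ε) :
    ∃ n : ℕ, ∀ f : RN N → ℂ, AEStronglyMeasurable f →
      eLpNorm f (ENNReal.ofReal q) ((weightedVolume N b).restrict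
        (Metric.closedBall (0 : RN N) n)ᶜ) ≤ ε * eLpNorm f (ENNReal.ofReal r) := by
  have hN0 : (0 : ℝ) < N := by exact_mod_cast hN
  obtain ⟨hs, e⟩ := holderConjugate_div hq hqr
  set s := (r / q).conjExponent
  have hs0 := hs.symm.pos
  have c : N < b * s := by
    have : 1 / s < b / N := by rw [e]; linarith
    rwa [div_lt_div_iff₀ hs0 hN0, one_mul] at this
  set W : RN N → ℝ≥0∞ := fun x => ENNReal.ofReal (‖x‖ ^ (-(b * s)))
  have hK : ∀ n : ℕ, MeasurableSet (Metric.closedBall (0 : RN N) n)ᶜ := fun n =>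
    Metric.isClosed_closedBall.measurableSet.compl
  have hlim : Tendsto (fun n : ℕ => ∫⁻ x in (Metric.closedBall (0 : RN N) n)ᶜ, W x) atTop (𝓝 0) := by
    -- Continuity from above: the exteriors decrease to ∅, and the one with n = 1 has finite mass.
    have h := tendsto_measure_iInter_atTop (μ := volume.withDensity W)
      (s := fun n : ℕ => (Metric.closedBall (0 : RN N) n)ᶜ) (fun n => (hK n).nullMeasurableSet)
      (fun m n hmn => Set.compl_subset_compl.2 (Metric.closedBall_subset_closedBall
        (by exact_mod_cast hmn))) ⟨1, ?_⟩
    · have h0 : ⋂ n : ℕ, (Metric.closedBall (0 : RN N) n)ᶜ = ∅ := by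
        rw [← Set.compl_iUnion, Metric.iUnion_closedBall_nat, Set.compl_univ]
      rw [h0, measure_empty] at h
      simpa only [Function.comp_def, withDensity_apply _ (hK _)] using h
    · rw [withDensity_apply _ (hK 1)]
      refine ne_of_lt (lt_of_le_of_lt (lintegral_mono_set ?_)
        (lintegral_compl_ball_norm_rpow_lt_top c))
      exact Set.compl_subset_compl.2 (by simpa using Metric.ball_subset_closedBall)
  have hlim2 : Tendsto (fun n : ℕ => ((∫⁻ x in (Metric.closedBall (0 : RN N) n)ᶜ, W x) ^ (1 / s)) ^
      (1 / q)) atTop (𝓝 0) := by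
    have h1 := ((ENNReal.continuous_rpow_const (y := 1 / s)).tendsto _).comp hlim
    have h2 := ((ENNReal.continuous_rpow_const (y := 1 / q)).tendsto _).comp h1
    rwa [ENNReal.zero_rpow_of_pos (by positivity), ENNReal.zero_rpow_of_pos (by positivity)] at h2
  obtain ⟨n, hn⟩ := (ENNReal.tendsto_nhds_zero.1 hlim2 ε hε).exists
  refine ⟨n, fun f hf => (eLpNorm_weightedVolume_restrict_le hq hs (hK n) hf).trans ?_⟩
  gcongr

/-- The weight is integrable on the unit ball as b < N, and at most 1 elsewhere. Step functions on
balls thus lie in the weighted space. -/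
theorem weightedVolume_closedBall_lt_top {N : ℕ} (hN : 1 ≤ N) {b : ℝ} (hb : 0 < b) (hbN : b < N)
    (R : ℝ) : weightedVolume N b (Metric.closedBall 0 R) < ∞ := by
  have hB := (Metric.isOpen_ball (x := (0 : RN N)) (ε := 1)).measurableSet
  have hK : MeasurableSet (Metric.closedBall (0 : RN N) R) := Metric.isClosed_closedBall.measurableSet
  rw [← measure_inter_add_sdiff _ hB]
  refine ENNReal.add_lt_top.2 ⟨(measure_mono Set.inter_subset_right).trans_lt ?_, ?_⟩
  · rw [weightedVolume, withDensity_apply _ hB]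
    exact lintegral_ball_norm_rpow_lt_top hN hbN
  · rw [weightedVolume, withDensity_apply _ (hK.diff hB)]
    calc _ ≤ ∫⁻ x in Metric.closedBall (0 : RN N) R \ Metric.ball 0 1, 1 := by
          refine setLIntegral_mono' (hK.diff hB) fun x hx => ?_
          have hx1 : 1 ≤ ‖x‖ := by simpa using hx.2
          rw [← ENNReal.ofReal_one]
          exact ENNReal.ofReal_le_ofReal (Real.rpow_le_one_of_one_le_of_nonpos hx1 (by linarith))
      _ ≤ volume (Metric.closedBall (0 : RN N) R) := by
          rw [setLIntegral_one]; exact measure_mono Set.sdiff_subset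
      _ < ∞ := measure_closedBall_lt_top

/-! ### Choice of exponents. -/

/-- The exponents on either side of the scaling-critical one used in the interpolation. -/
theorem exists_exponents {N : ℕ} (hN : 1 ≤ N) {b : ℝ} (hb : 0 < b) (hb' : b < min (N : ℝ) 4)
    {σ : ℝ} (hσ : 0 < σ) (hσ' : (σ : EReal) < fourStar N b) {p : ℝ}
    (hp' : p < (2 * σ + 2) * N / (N - b)) :
    ∃ r₁ r₂ : ℝ, 2 * σ + 2 < r₁ ∧ 2 * σ + 2 < r₂ ∧ p ≤ r₁ ∧ p ≤ r₂ ∧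
      N * (1 / 2 - 1 / r₁) < 2 ∧ N * (1 / 2 - 1 / r₂) < 2 ∧
      (2 * σ + 2) / r₁ < 1 - b / N ∧ 1 - b / N < (2 * σ + 2) / r₂ := by
  have hN0 : (0 : ℝ) < N := by exact_mod_cast hN
  have hbN : b < N := hb'.trans_le (min_le_left _ _)
  have hb4 : b < 4 := hb'.trans_le (min_le_right _ _)
  set q := 2 * σ + 2 with hq
  have hq0 : 0 < q := by positivity
  have hNb : 0 < N - b := sub_pos.2 hbN
  set Q := q * N / (N - b) with hQ
  have hQ0 : 0 < Q := by positivity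
  have hqQ : q < Q := by
    rw [hQ, lt_div_iff₀ hNb]; nlinarith
  have hQinv : 1 / Q = (N - b) / (q * N) := by rw [hQ, one_div_div]
  -- Cleared of denominators this reads (N - 4)(σ + 1) < N - b, which is σ < 4^* for N ≥ 5 and
  -- automatic for N ≤ 4.
  have hcrit : 1 / 2 - 2 / N < 1 / Q := by
    rw [hQinv, lt_div_iff₀ (by positivity)]
    have e : (1 / 2 - 2 / (N : ℝ)) * (q * N) = (N - 4) * (σ + 1) := by
      rw [hq]; field_simp; ring
    rw [e]
    by_cases h5 : 5 ≤ N
    · rw [fourStar, if_pos h5, EReal.coe_lt_coe_iff] at hσ'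
      have h5' : (5 : ℝ) ≤ N := by exact_mod_cast h5
      rw [lt_div_iff₀ (by linarith)] at hσ'
      linarith
    · have h4 : (N : ℝ) ≤ 4 := by exact_mod_cast (by omega : N ≤ 4)
      nlinarith
  have key : ∀ r : ℝ, q / r = q * (1 / r) := fun r => by ring
  have hbNQ : 1 - b / N = q * (1 / Q) := by rw [hQinv]; field_simp
  have h0Q : 0 < 1 / Q := by positivity
  -- t is 1/r₁. Working with reciprocals treats finite and infinite Sobolev exponents alike; the
  -- maximum with 0 keeps r₁ finite.
  obtain ⟨t, ht1, ht2⟩ := exists_between (max_lt h0Q hcrit)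
  have ht0 : 0 < t := (le_max_left _ _).trans_lt ht1
  have htc : 1 / 2 - 2 / N < t := (le_max_right _ _).trans_lt ht1
  have hQt : Q < 1 / t := by rwa [lt_one_div hQ0 ht0]
  -- The strict inequality p < Q leaves room for r₂ ≥ p below Q.
  obtain ⟨r₂, hr1, hr2⟩ := exists_between (max_lt hp' hqQ)
  have hr0 : 0 < r₂ := (hq0.trans_le (le_max_right _ _)).trans hr1
  have hrt : 1 / Q < 1 / r₂ := one_div_lt_one_div_of_lt hr0 hr2
  have hsub : ∀ z : ℝ, 1 / 2 - 2 / N < z → N * (1 / 2 - z) < 2 := by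
    intro z hz
    have : N * (1 / 2 - 2 / N) < N * z := mul_lt_mul_of_pos_left hz hN0
    have e : (N : ℝ) * (1 / 2 - 2 / N) = N / 2 - 2 := by field_simp
    linarith
  refine ⟨1 / t, r₂, hqQ.trans hQt, (le_max_right _ _).trans_lt hr1, (hp'.trans hQt).le,
    ((le_max_left _ _).trans_lt hr1).le, hsub _ ?_, hsub _ (hcrit.trans hrt), ?_, ?_⟩
  · rwa [one_div_one_div]
  · rw [key, hbNQ, one_div_one_div]; gcongr
  · rw [key, hbNQ]; gcongr

/-! ### From norm estimates to continuous and compact operators. -/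

theorem norm_le_of_enorm_le_mul {X Y : Type*} [NormedAddCommGroup X] [NormedAddCommGroup Y]
    {y : Y} {x : X} {C : ℝ≥0∞}
    (hC : C ≠ ∞) (h : ‖y‖ₑ ≤ C * ‖x‖ₑ) : ‖y‖ ≤ C.toReal * ‖x‖ := by
  have := ENNReal.toReal_mono (ENNReal.mul_ne_top hC enorm_ne_top) h
  rwa [ENNReal.toReal_mul, toReal_enorm, toReal_enorm] at this

/-- An almost everywhere linear family of functions with bounded `L^q` norms defines a continuous
linear map into `L^q`. -/
theorem exists_clm_Lp {α X : Type*} [MeasurableSpace α]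
    {μ : Measure α} {q : ℝ≥0∞} [Fact (1 ≤ q)]
    [NormedAddCommGroup X] [NormedSpace ℂ X] {U : X → α → ℂ} (hm : ∀ w, AEStronglyMeasurable (U w) μ)
    (hadd : ∀ v w, U (v + w) =ᵐ[μ] U v + U w) (hsmul : ∀ (c : ℂ) w, U (c • w) =ᵐ[μ] c • U w)
    {C : ℝ≥0∞} (hC : C ≠ ∞) (hU : ∀ w, eLpNorm (U w) q μ ≤ C * ‖w‖ₑ) :
    ∃ T : X →L[ℂ] Lp ℂ q μ, ∀ w, (T w : α → ℂ) =ᵐ[μ] U w := by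
  have hmem : ∀ w, MemLp (U w) q μ := fun w =>
    ⟨hm w, (hU w).trans_lt (ENNReal.mul_lt_top hC.lt_top enorm_lt_top)⟩
  let T₀ : X →ₗ[ℂ] Lp ℂ q μ :=
    { toFun := fun w => (hmem w).toLp (U w)
      map_add' := fun v w => by
        rw [← MemLp.toLp_add]
        exact MemLp.toLp_congr _ _ (hadd v w)
      map_smul' := fun c w => by
        rw [RingHom.id_apply, ← MemLp.toLp_const_smul]
        exact MemLp.toLp_congr _ _ (hsmul c w) }
  refine ⟨T₀.mkContinuous C.toReal fun w => norm_le_of_enorm_le_mul hC ?_, fun w =>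
    (hmem w).coeFn_toLp⟩
  rw [Lp.enorm_def]
  exact (eLpNorm_congr_ae (hmem w).coeFn_toLp).le.trans (hU w)

theorem coeFn_Lp_sum {α ι : Type*} [MeasurableSpace α] {μ : Measure α} {q : ℝ≥0∞}
    (t : Finset ι) (f : ι → Lp ℂ q μ) :
    ((∑ i ∈ t, f i : Lp ℂ q μ) : α → ℂ) =ᵐ[μ] fun x => ∑ i ∈ t, f i x := by
  classical
  induction t using Finset.induction_on with
  | empty =>
    filter_upwards [Lp.coeFn_zero ℂ q μ] with x hx
    simpa using hx
  | insert i t hi ih =>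
    rw [Finset.sum_insert hi]
    filter_upwards [Lp.coeFn_add (f i) (∑ j ∈ t, f j), ih] with x hx hx'
    rw [hx, Pi.add_apply, hx', Finset.sum_insert hi]

/-- A continuous linear map into `L^q` that can be approximated by step functions with
continuously varying coefficients is compact. -/
theorem isCompactOperator_of_forall_exists_simpleFunc {α β X : Type*} [MeasurableSpace α] {μ : Measure α} {q : ℝ≥0∞} [Fact (1 ≤ q)]
    [NormedAddCommGroup X] [NormedSpace ℂ X]  {T : X →L[ℂ] Lp ℂ q μ}
    (h : ∀ ε : ℝ≥0∞, 0 < ε → ∃ (K : Set α) (s : SimpleFunc α β) (ℓ : β → X →L[ℂ] ℂ),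
      MeasurableSet K ∧ μ K ≠ ∞ ∧
      ∀ w, eLpNorm ((T w : α → ℂ) - K.indicator fun x => ℓ (s x) w) q μ ≤ ε * ‖w‖ₑ) :
    IsCompactOperator T := by
  -- Compact operators are closed in operator norm, so approximation by finite-rank maps is enough.
  suffices hT : T ∈ closure {f : X →L[ℂ] Lp ℂ q μ | IsCompactOperator f} by
    rwa [isClosed_setOfPred_isCompactOperator.closure_eq] at hT
  rw [Metric.mem_closure_iff]
  intro ε hε
  obtain ⟨K, s, ℓ, hK, hKμ, hs⟩ := h (ENNReal.ofReal (ε / 2)) (by simpa using hε)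
  have hm : ∀ z, MeasurableSet (K ∩ s ⁻¹' {z}) := fun z => hK.inter (s.measurableSet_fiber z)
  have hμ : ∀ z, μ (K ∩ s ⁻¹' {z}) ≠ ∞ := fun z => ne_top_of_le_ne_top hKμ
    (measure_mono Set.inter_subset_left)
  let e : β → Lp ℂ q μ := fun z => indicatorConstLp q (hm z) (hμ z) (1 : ℂ)
  let F : X →L[ℂ] Lp ℂ q μ := ∑ z ∈ s.range, (ℓ z).smulRight (e z)
  have hF : F ∈ compactOperator (RingHom.id ℂ) X (Lp ℂ q μ) := by
    refine Submodule.sum_mem _ fun z _ => ?_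
    have h := (isCompactOperator_of_locallyCompactSpace_rng
      ((1 : ℂ →L[ℂ] ℂ).smulRight (e z))).comp_clm (ℓ z)
    change IsCompactOperator fun x => ℓ z x • e z
    simpa [Function.comp_def] using h
  refine ⟨F, hF, ?_⟩
  have hFw : ∀ w, (F w : α → ℂ) =ᵐ[μ] K.indicator fun x => ℓ (s x) w := by
    intro w
    have e1 : F w = ∑ z ∈ s.range, ℓ z w • e z := by simp [F]
    have e2 : ∀ᵐ x ∂μ, ∀ z ∈ s.range, (ℓ z w • e z : Lp ℂ q μ) x =
        (K ∩ s ⁻¹' {z}).indicator (fun _ => ℓ z w) x := by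
      rw [Filter.eventually_all_finset]
      intro z _
      filter_upwards [Lp.coeFn_smul (ℓ z w) (e z),
        indicatorConstLp_coeFn (p := q) (hs := hm z) (hμs := hμ z) (c := (1 : ℂ))] with x hx hx'
      rw [hx, Pi.smul_apply, hx']
      by_cases hxK : x ∈ K ∩ s ⁻¹' {z} <;> simp [hxK]
    rw [e1]
    filter_upwards [coeFn_Lp_sum s.range fun z => ℓ z w • e z, e2] with x hx hx'
    rw [hx, Finset.sum_congr rfl hx', Finset.sum_eq_single (s x)]
    · by_cases hxK : x ∈ K <;> simp [hxK]
    · intro z _ hz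
      refine Set.indicator_of_notMem (fun hmem => hz ?_) _
      exact hmem.2.symm
    · exact fun hx => (hx (s.mem_range_self x)).elim
  rw [dist_eq_norm]
  refine lt_of_le_of_lt (ContinuousLinearMap.opNorm_le_bound _ (half_pos hε).le fun w => ?_)
    (half_lt_self hε)
  have h1 := norm_le_of_enorm_le_mul (x := w) (y := (T - F) w) (C := ENNReal.ofReal (ε / 2))
    ENNReal.ofReal_ne_top ?_
  · rwa [ENNReal.toReal_ofReal (half_pos hε).le] at h1
  · rw [Lp.enorm_def]
    refine (le_of_eq (eLpNorm_congr_ae ?_)).trans (hs w)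
    rw [sub_apply]
    exact (Lp.coeFn_sub _ _).trans (EventuallyEq.rfl.sub (hFw w))

/-- On a compact ball, averages are uniformly approximated by step functions. -/
theorem exists_simpleFunc_smoothing {N : ℕ} (hN : 1 ≤ N) {b : ℝ} (hb : 0 < b) (hbN : b < N)
    {q : ℝ} (κ : 𝓢(RN N, ℂ)) {p : ℝ} (hp : 1 < p) (l : ℝˣ) {R : ℝ} (hR : 0 ≤ R) {ε : ℝ≥0∞}
    (hε : 0 < ε) : ∃ s : SimpleFunc (RN N) (RN N), ∀ u : RN N → ℂ, MemLp u (ENNReal.ofReal p) →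
      eLpNorm (fun x => smoothing κ l u x - smoothing κ l u (s x)) (ENNReal.ofReal q)
        ((weightedVolume N b).restrict (Metric.closedBall 0 R)) ≤
        ε * eLpNorm u (ENNReal.ofReal p) := by
  obtain ⟨C, hC, h⟩ := exists_enorm_smoothing_sub_le κ hp l (show 0 ≤ R + 1 by positivity)
  set m := weightedVolume N b (Metric.closedBall 0 R) ^ (ENNReal.ofReal q).toReal⁻¹
  have hm : m ≠ ∞ := ENNReal.rpow_ne_top_of_nonneg (by simp)
    (weightedVolume_closedBall_lt_top hN hb hbN R).ne
  obtain ⟨δ, hδ, hδε⟩ : ∃ δ : ℝ≥0∞, 0 < δ ∧ δ * (C * m) ≤ ε :=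
    ⟨ε / (C * m), ENNReal.div_pos hε.ne' (ENNReal.mul_ne_top hC hm), by
      rw [mul_comm]; exact ENNReal.mul_div_le⟩
  -- The cap at 1 keeps nearest points within radius R + 1, where the Lipschitz bound was taken; δ
  -- itself is infinite if `C * m = 0`.
  set η := min δ 1
  have hη : 0 < η := lt_min hδ one_pos
  set e := TopologicalSpace.denseSeq (RN N)
  obtain ⟨n, hn⟩ : ∃ n : ℕ, Metric.closedBall (0 : RN N) R ⊆
      ⋃ k ≤ n, {x | edist (e k) x < η} := by
    refine (isCompact_closedBall (0 : RN N) R).elim_directed_cover _ (fun n => ?_) (fun x _ => ?_)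
      (Monotone.directed_le fun m n hmn => ?_)
    · refine isOpen_biUnion fun k _ => isOpen_lt (by fun_prop) continuous_const
    · obtain ⟨_, ⟨k, rfl⟩, hk⟩ := EMetric.mem_closure_iff.1
        (TopologicalSpace.denseRange_denseSeq (RN N) x) η hη
      refine Set.mem_iUnion.2 ⟨k, Set.mem_iUnion₂.2 ⟨k, le_rfl, ?_⟩⟩
      rwa [Set.mem_ofPred_eq, edist_comm]
    · exact Set.biUnion_subset_biUnion_left fun k hk => le_trans hk hmn
  refine ⟨SimpleFunc.nearestPt e n, fun u hu => ?_⟩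
  have hs : ∀ x ∈ Metric.closedBall (0 : RN N) R,
      ‖smoothing κ l u x - smoothing κ l u (SimpleFunc.nearestPt e n x)‖ₑ ≤
        δ * (C * eLpNorm u (ENNReal.ofReal p)) := by
    intro x hx
    obtain ⟨k, hk, hkx⟩ := Set.mem_iUnion₂.1 (hn hx)
    have hd : edist (SimpleFunc.nearestPt e n x) x < η :=
      (SimpleFunc.edist_nearestPt_le e x hk).trans_lt hkx
    have hd1 : dist (SimpleFunc.nearestPt e n x) x ≤ 1 := by
      have : edist (SimpleFunc.nearestPt e n x) x ≤ ENNReal.ofReal 1 := by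
        rw [ENNReal.ofReal_one]; exact hd.le.trans (min_le_right _ _)
      rwa [edist_dist, ENNReal.ofReal_le_ofReal_iff zero_le_one] at this
    rw [mem_closedBall_zero_iff] at hx
    refine (h u hu x ?_ _ ?_).trans ?_
    · rw [mem_closedBall_zero_iff]; linarith
    · rw [mem_closedBall_zero_iff]
      rw [dist_eq_norm] at hd1
      have := norm_add_le (SimpleFunc.nearestPt e n x - x) x
      rw [sub_add_cancel] at this
      linarith
    · gcongr
      rw [edist_comm]
      exact hd.le.trans (min_le_left _ _)
  have hae : ∀ᵐ x ∂(weightedVolume N b).restrict (Metric.closedBall 0 R),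
      ‖smoothing κ l u x - smoothing κ l u (SimpleFunc.nearestPt e n x)‖ₑ ≤
        δ * (C * eLpNorm u (ENNReal.ofReal p)) :=
    (ae_restrict_iff' Metric.isClosed_closedBall.measurableSet).2 (Eventually.of_forall hs)
  refine (eLpNorm_le_of_ae_enorm_bound hae).trans ?_
  rw [Measure.restrict_apply_univ, smul_eq_mul]
  calc _ = δ * (C * m) * eLpNorm u (ENNReal.ofReal p) := by ring
    _ ≤ _ := by gcongr

/-! ### The embedding: continuity and compactness. -/

section Embedding

variable {N : ℕ} {p : ℝ} [Fact (1 ≤ ENNReal.ofReal p)]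

theorem eLpNorm_fst_le (w : HdotTwoInterLp N (ENNReal.ofReal p)) :
    eLpNorm w.1.1 (ENNReal.ofReal p) ≤ ‖w‖ₑ := by
  rw [← Lp.enorm_def]
  exact enorm_le_iff_norm_le.2 (norm_fst_le w.1)

theorem eLpNorm_snd_le (w : HdotTwoInterLp N (ENNReal.ofReal p)) : eLpNorm w.1.2 2 ≤ ‖w‖ₑ := by
  rw [← Lp.enorm_def]
  exact enorm_le_iff_norm_le.2 (norm_snd_le w.1)

theorem coeFn_fst_add (v w : HdotTwoInterLp N (ENNReal.ofReal p)) :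
    ((v + w).1.1 : RN N → ℂ) =ᵐ[volume] (v.1.1 : RN N → ℂ) + (w.1.1 : RN N → ℂ) := by
  rw [Submodule.coe_add, Prod.fst_add]
  exact Lp.coeFn_add _ _

theorem coeFn_fst_smul (c : ℂ) (w : HdotTwoInterLp N (ENNReal.ofReal p)) :
    ((c • w).1.1 : RN N → ℂ) =ᵐ[volume] c • (w.1.1 : RN N → ℂ) := by
  rw [Submodule.coe_smul, Prod.smul_fst]
  exact Lp.coeFn_smul _ _

theorem exists_clm_of_eLpNorm_le {μ : Measure (RN N)} (hac : μ ≪ volume) {q : ℝ≥0∞}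
    [Fact (1 ≤ q)] {C : ℝ≥0∞} (hC : C ≠ ∞) (h : ∀ w : HdotTwoInterLp N (ENNReal.ofReal p),
      eLpNorm (w.1.1 : RN N → ℂ) q μ ≤ C * ‖w‖ₑ) :
    ∃ T : HdotTwoInterLp N (ENNReal.ofReal p) →L[ℂ] Lp ℂ q μ,
      ∀ w, (T w : RN N → ℂ) =ᵐ[μ] (w.1.1 : RN N → ℂ) := by
  have h' := exists_clm_Lp (X := HdotTwoInterLp N (ENNReal.ofReal p)) (μ := μ) (q := q)
    (U := fun w => (w.1.1 : RN N → ℂ)) (fun w => (Lp.memLp w.1.1).1.mono_ac hac)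
  exact h' (fun v w => hac.ae_eq (coeFn_fst_add v w)) (fun c w => hac.ae_eq (coeFn_fst_smul c w))
    hC h

/-- Evaluation of an average, as a continuous linear functional. -/
noncomputable def smoothingCLM (κ : 𝓢(RN N, ℂ)) (l : ℝˣ) (x : RN N) :
    HdotTwoInterLp N (ENNReal.ofReal p) →L[ℂ] ℂ :=
  PointwiseConvergenceCLM.evalCLM (RingHom.id ℂ) ℂ (dilate l x κ) ∘L
    Lp.toTemperedDistributionCLM ℂ volume (ENNReal.ofReal p) ∘L
    ContinuousLinearMap.fst ℂ _ _ ∘L (HdotTwoInterLp N (ENNReal.ofReal p)).subtypeL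

theorem smoothingCLM_apply (κ : 𝓢(RN N, ℂ)) (l : ℝˣ) (x : RN N)
    (w : HdotTwoInterLp N (ENNReal.ofReal p)) :
    smoothingCLM κ l x w = smoothing κ l w.1.1 x := by
  change Lp.toTemperedDistribution w.1.1 (dilate l x κ) = _
  rw [Lp.toTemperedDistribution_apply]
  rfl

/-- Convergence of the Littlewood–Paley averages in the weighted space. -/
theorem exists_eLpNorm_weightedVolume_sub_smoothing_le (hN : 1 ≤ N) (hp : 1 < p) {b q r₁ r₂ : ℝ}
    (hq : 2 ≤ q) (hq₁ : q < r₁) (hq₂ : q < r₂) (hN₁ : N * (1 / 2 - 1 / r₁) < 2)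
    (hN₂ : N * (1 / 2 - 1 / r₂) < 2) (hw₁ : q / r₁ < 1 - b / N) (hw₂ : 1 - b / N < q / r₂) :
    ∃ (κ : 𝓢(RN N, ℂ)) (A : ℕ → ℝ≥0∞), A 0 ≠ ∞ ∧ Tendsto A atTop (𝓝 0) ∧
      ∀ (k : ℕ) (w : HdotTwoInterLp N (ENNReal.ofReal p)),
        eLpNorm ((w.1.1 : RN N → ℂ) - smoothing κ (twoPow k) w.1.1) (ENNReal.ofReal q)
          (weightedVolume N b) ≤ A k * ‖w‖ₑ := by
  obtain ⟨κ, E, hκ, hE⟩ := exists_littlewoodPaley_kernels N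
  obtain ⟨C, hC, hCle⟩ := exists_eLpNorm_weightedVolume_le hN (one_le_two.trans hq) hq₁ hq₂ hw₁ hw₂
  obtain ⟨C₁, ρ₁, hC₁, hρ₁, h₁⟩ := exists_eLpNorm_sub_smoothing_le hκ hE
    (hq.trans hq₁.le) hN₁ hp
  obtain ⟨C₂, ρ₂, hC₂, hρ₂, h₂⟩ := exists_eLpNorm_sub_smoothing_le hκ hE
    (hq.trans hq₂.le) hN₂ hp
  refine ⟨κ, fun k => C * (ρ₁ ^ k * C₁ + ρ₂ ^ k * C₂), ?_, ?_, fun k w => ?_⟩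
  · simpa using ENNReal.mul_ne_top hC (ENNReal.add_ne_top.2 ⟨hC₁, hC₂⟩)
  · have t₁ := ENNReal.Tendsto.mul_const (ENNReal.tendsto_pow_atTop_nhds_zero_of_lt_one hρ₁)
      (Or.inr hC₁)
    have t₂ := ENNReal.Tendsto.mul_const (ENNReal.tendsto_pow_atTop_nhds_zero_of_lt_one hρ₂)
      (Or.inr hC₂)
    have t := ENNReal.Tendsto.const_mul (t₁.add t₂) (Or.inr hC)
    rwa [zero_mul, zero_mul, add_zero, mul_zero] at t
  · have hmem : MemLp w.1.1 (ENNReal.ofReal p) := Lp.memLp w.1.1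
    refine (hCle _ (hmem.1.sub (continuous_smoothing κ hp _ hmem).aestronglyMeasurable)).trans ?_
    have e : C * (ρ₁ ^ k * C₁ + ρ₂ ^ k * C₂) * ‖w‖ₑ =
        C * (ρ₁ ^ k * (C₁ * ‖w‖ₑ) + ρ₂ ^ k * (C₂ * ‖w‖ₑ)) := by ring
    rw [e]
    have hsnd := eLpNorm_snd_le w
    refine mul_le_mul_right (add_le_add ?_ ?_) C
    · exact (h₁ w k).trans (mul_le_mul_right (mul_le_mul_right hsnd _) _)
    · exact (h₂ w k).trans (mul_le_mul_right (mul_le_mul_right hsnd _) _)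

/-- Bernstein from L^p to both exponents, which is where p ≤ r₁ and p ≤ r₂ enter. This is the
low-frequency half of continuity. -/
theorem exists_eLpNorm_weightedVolume_smoothing_le (hN : 1 ≤ N) (hp : 1 < p) {b q r₁ r₂ : ℝ}
    (hq : 1 ≤ q) (hq₁ : q < r₁) (hq₂ : q < r₂) (hp₁ : p ≤ r₁) (hp₂ : p ≤ r₂)
    (hw₁ : q / r₁ < 1 - b / N) (hw₂ : 1 - b / N < q / r₂) (κ : 𝓢(RN N, ℂ)) (l : ℝˣ) :
    ∃ D : ℝ≥0∞, D ≠ ∞ ∧ ∀ w : HdotTwoInterLp N (ENNReal.ofReal p),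
      eLpNorm (smoothing κ l w.1.1) (ENNReal.ofReal q) (weightedVolume N b) ≤ D * ‖w‖ₑ := by
  obtain ⟨C, hC, hCle⟩ := exists_eLpNorm_weightedVolume_le hN hq hq₁ hq₂ hw₁ hw₂
  obtain ⟨B₁, hB₁, hB₁le⟩ := exists_eLpNorm_smoothing_le κ hp hp₁
  obtain ⟨B₂, hB₂, hB₂le⟩ := exists_eLpNorm_smoothing_le κ hp hp₂
  refine ⟨C * (ENNReal.ofReal ((|(l : ℝ)| ^ N) ^ (1 / p - 1 / r₁)) * B₁ +
    ENNReal.ofReal ((|(l : ℝ)| ^ N) ^ (1 / p - 1 / r₂)) * B₂), ENNReal.mul_ne_top hC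
    (ENNReal.add_ne_top.2 ⟨ENNReal.mul_ne_top ENNReal.ofReal_ne_top hB₁,
      ENNReal.mul_ne_top ENNReal.ofReal_ne_top hB₂⟩), fun w => ?_⟩
  have hmem : MemLp w.1.1 (ENNReal.ofReal p) := Lp.memLp w.1.1
  have hfst := eLpNorm_fst_le w
  refine (hCle _ (continuous_smoothing κ hp _ hmem).aestronglyMeasurable).trans ?_
  rw [mul_assoc, add_mul]
  refine mul_le_mul_right (add_le_add ?_ ?_) C
  · exact (hB₁le l _ hmem).trans (mul_le_mul_right hfst _)
  · exact (hB₂le l _ hmem).trans (mul_le_mul_right hfst _)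

/-- With P an average of u and S its discretisation, the three terms are the high-frequency, tail
and discretisation errors. -/
theorem eLpNorm_sub_indicator_le {α : Type*} [MeasurableSpace α] {μ : Measure α} {q : ℝ≥0∞}
    (hq : 1 ≤ q) {u P S : α → ℂ} (hu : AEStronglyMeasurable u μ) (hP : AEStronglyMeasurable P μ)
    (hS : AEStronglyMeasurable S μ) {K : Set α} (hK : MeasurableSet K) :
    eLpNorm (u - K.indicator S) q μ ≤ eLpNorm (u - P) q μ + eLpNorm P q (μ.restrict Kᶜ) +
      eLpNorm (fun x => P x - S x) q (μ.restrict K) := by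
  have e : u - K.indicator S = (u - P) + Kᶜ.indicator P + K.indicator (P - S) := by
    ext x
    by_cases hxK : x ∈ K <;> simp [hxK]
  have m₁ := hu.sub hP
  have m₂ := hP.indicator hK.compl
  have m₃ := (hP.sub hS).indicator hK
  change _ ≤ _ + _ + eLpNorm (P - S) q (μ.restrict K)
  rw [e, ← eLpNorm_indicator_eq_eLpNorm_restrict hK.compl,
    ← eLpNorm_indicator_eq_eLpNorm_restrict hK]
  exact (eLpNorm_add_le (m₁.add m₂) m₃ hq).trans (add_le_add (eLpNorm_add_le m₁ m₂ hq) le_rfl)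

/-- Uniform approximation of bounded sets of the homogeneous Sobolev space by step functions, in
the weighted space. -/
theorem exists_eLpNorm_sub_indicator_smoothing_le (hN : 1 ≤ N) {b : ℝ} (hb : 0 < b) (hbN : b < N)
    (hp : 1 < p) {q r : ℝ} (hq : 1 ≤ q) (hqr : q < r) (hpr : p ≤ r) (hw : 1 - b / N < q / r)
    {κ : 𝓢(RN N, ℂ)} {A : ℕ → ℝ≥0∞} (hA : Tendsto A atTop (𝓝 0))
    (hAle : ∀ (k : ℕ) (w : HdotTwoInterLp N (ENNReal.ofReal p)),
      eLpNorm ((w.1.1 : RN N → ℂ) - smoothing κ (twoPow k) w.1.1) (ENNReal.ofReal q)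
        (weightedVolume N b) ≤ A k * ‖w‖ₑ) {ε : ℝ≥0∞} (hε : 0 < ε) :
    ∃ (n k : ℕ) (s : SimpleFunc (RN N) (RN N)), ∀ w : HdotTwoInterLp N (ENNReal.ofReal p),
      eLpNorm ((w.1.1 : RN N → ℂ) - (Metric.closedBall (0 : RN N) n).indicator
        fun x => smoothing κ (twoPow k) w.1.1 (s x)) (ENNReal.ofReal q) (weightedVolume N b) ≤
          ε * ‖w‖ₑ := by
  have hε3 : 0 < ε / 3 := ENNReal.div_pos hε.ne' (by norm_num)
  obtain ⟨k, hk⟩ := (ENNReal.tendsto_nhds_zero.1 hA _ hε3).exists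
  obtain ⟨B, hB, hBle⟩ := exists_eLpNorm_smoothing_le κ hp hpr
  have hBk := hBle (twoPow k)
  have hG : ENNReal.ofReal ((|(twoPow k : ℝ)| ^ N) ^ (1 / p - 1 / r)) * B ≠ ∞ :=
    ENNReal.mul_ne_top ENNReal.ofReal_ne_top hB
  generalize ENNReal.ofReal ((|(twoPow k : ℝ)| ^ N) ^ (1 / p - 1 / r)) * B = G at hBk hG
  obtain ⟨n, hn⟩ := exists_eLpNorm_weightedVolume_restrict_compl_le hN (one_pos.trans_le hq) hqr hw
    (ENNReal.div_pos hε3.ne' hG)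
  obtain ⟨s, hs⟩ := exists_simpleFunc_smoothing hN hb hbN (q := q) κ hp (twoPow k)
    (Nat.cast_nonneg n) hε3
  refine ⟨n, k, s, fun w => ?_⟩
  have hmem : MemLp w.1.1 (ENNReal.ofReal p) := Lp.memLp w.1.1
  have hP := continuous_smoothing κ hp (twoPow k) hmem
  have hfst := eLpNorm_fst_le w
  refine (eLpNorm_sub_indicator_le (by simpa using hq) (hmem.1.mono_ac (weightedVolume_ac b))
    hP.aestronglyMeasurable
    (hP.comp_stronglyMeasurable s.stronglyMeasurable).aestronglyMeasurable
    Metric.isClosed_closedBall.measurableSet).trans ?_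
  rw [← ENNReal.add_thirds ε, add_mul, add_mul]
  refine add_le_add (add_le_add ?_ ?_) ?_
  · exact (hAle k w).trans (mul_le_mul_left hk _)
  · refine (hn _ hP.aestronglyMeasurable).trans ?_
    calc _ ≤ ε / 3 / G * (G * ‖w‖ₑ) :=
          mul_le_mul_right ((hBk _ hmem).trans (mul_le_mul_right hfst _)) _
      _ = G * (ε / 3 / G) * ‖w‖ₑ := by ring
      _ ≤ ε / 3 * ‖w‖ₑ := mul_le_mul_left ENNReal.mul_div_le _
  · exact (hs _ hmem).trans (mul_le_mul_right hfst _)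

end Embedding

set_option maxHeartbeats 1000000 in
/-- The two `Fact` arguments follow from `hp` and `hσ`; they only serve to make the spaces `L^p` and
`L^{2σ+2}(|x|^{-b} dx)` normed spaces. -/
theorem proposition4p2 (N : ℕ) (hN : 1 ≤ N) (b : ℝ) (hb : 0 < b) (hb' : b < min (N : ℝ) 4)
    (σ : ℝ) (hσ : 0 < σ) (hσ' : (σ : EReal) < fourStar N b)
    (p : ℝ) (hp : 1 < p) (hp' : p < (2 * σ + 2) * N / (N - b))
    [Fact (1 ≤ ENNReal.ofReal p)] [Fact (1 ≤ ENNReal.ofReal (2 * σ + 2))] :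
    ∃ T : HdotTwoInterLp N (ENNReal.ofReal p) →L[ℂ]
        Lp ℂ (ENNReal.ofReal (2 * σ + 2)) (weightedVolume N b),
      (∀ w : HdotTwoInterLp N (ENNReal.ofReal p),
        (T w : RN N → ℂ) =ᵐ[volume] (w.1.1 : RN N → ℂ)) ∧
      IsCompactOperator T := by
  have hbN : b < N := hb'.trans_le (min_le_left _ _)
  have hac := weightedVolume_ac (N := N) b
  obtain ⟨r₁, r₂, hq₁, hq₂, hp₁, hp₂, hN₁, hN₂, hw₁, hw₂⟩ := exists_exponents hN hb hb' hσ hσ' hp'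
  have hq2 : 2 ≤ 2 * σ + 2 := by linarith
  have hq1 : 1 ≤ 2 * σ + 2 := by linarith
  have hqF : 1 ≤ ENNReal.ofReal (2 * σ + 2) := Fact.out
  obtain ⟨κ, A, hA0, hA, hAle⟩ := exists_eLpNorm_weightedVolume_sub_smoothing_le hN hp hq2 hq₁ hq₂
    hN₁ hN₂ hw₁ hw₂
  -- Any fixed scale would do for continuity; `A 0` bounds the remainder at scale 1.
  obtain ⟨D, hD, hDle⟩ := exists_eLpNorm_weightedVolume_smoothing_le hN hp hq1 hq₁ hq₂ hp₁ hp₂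
    hw₁ hw₂ κ (twoPow 0)
  have hbound : ∀ w : HdotTwoInterLp N (ENNReal.ofReal p),
      eLpNorm (w.1.1 : RN N → ℂ) (ENNReal.ofReal (2 * σ + 2)) (weightedVolume N b) ≤
        (A 0 + D) * ‖w‖ₑ := by
    intro w
    have hP := (continuous_smoothing κ hp (twoPow 0) (Lp.memLp w.1.1)).aestronglyMeasurable
      (μ := weightedVolume N b)
    have h := eLpNorm_add_le (((Lp.memLp w.1.1).1.mono_ac hac).sub hP) hP hqF
    rw [sub_add_cancel] at h
    rw [add_mul]
    exact h.trans (add_le_add (hAle 0 w) (hDle w))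
  obtain ⟨T, hT⟩ := exists_clm_of_eLpNorm_le hac (ENNReal.add_ne_top.2 ⟨hA0, hD⟩) hbound
  refine ⟨T, fun w => (ac_weightedVolume hN b).ae_eq (hT w),
    isCompactOperator_of_forall_exists_simpleFunc (β := RN N) fun ε hε => ?_⟩
  obtain ⟨n, k, s, h⟩ := exists_eLpNorm_sub_indicator_smoothing_le hN hb hbN hp hq1 hq₂ hp₂ hw₂
    hA hAle hε
  refine ⟨Metric.closedBall 0 n, s, smoothingCLM κ (twoPow k),
    Metric.isClosed_closedBall.measurableSet,
    (weightedVolume_closedBall_lt_top hN hb hbN n).ne, fun w => ?_⟩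
  simp only [smoothingCLM_apply]
  refine (le_of_eq (eLpNorm_congr_ae ?_)).trans (h w)
  exact (hT w).sub EventuallyEq.rfl
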